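/- Let $T>0$, $\gamma\in\mathbb{R}\setminus\{0\}$, $\sigma=1/(\gamma T)$, and let $(\Omega,\mathcal{F},\mathbb{Q})$ be a probability space. Semilinear models. Given a probability density $f_{0T}$ on $\mathbb{R}$, a semilinear model over $[0,T]$ consists of a random variable $A_T$ with density $f_{0T}$ and an independent standard Brownian bridge $\{\beta_{tT}\}_{0\le t\le T}$ (a centred Gaussian process with a.s. continuous paths and covariance $s(T-t)/T$ for $s\le t$). One sets $\xi_{tT}=\sigma A_T t+\beta_{tT}$, $\mathcal{F}_t=\sigma(\{\xi_{sT}\}_{0\le s\le t})$, $\sigma_{tT}(x)=\sigma\frac{T}{T-t}x$ and, for $0\le t<T$, $$W_t=\xi_{tT}-\int_0^t\frac{1}{T-s}\left(\sigma T\,\mathbb{E}[A_T\mid\xi_{sT}]-\xi_{sT}\right)ds,$$ (with any jointly measurable version of $\mathbb{E}[A_T\mid\xi_{sT}]$), and $$f_{tT}(x)=\frac{f_{0T}(x)\exp\left[\frac{T}{T-t}\left(\sigma\xi_{tT}x-\tfrac12\sigma^2x^2t\right)\right]}{\int_{-\infty}^{\infty}f_{0T}(y)\exp\left[\frac{T}{T-t}\left(\sigma\xi_{tT}y-\tfrac12\sigma^2y^2t\right)\right]dy}.$$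 Proposition. Take $$f_{0T}(x)=\frac{|\sigma|\sqrt{T}}{\sqrt{2\pi}}\exp\left(-\tfrac12\sigma^2Tx^2\right),$$ which is the density of $N(0,1/(T\sigma^2))$. Then the semilinear models with this $f_{0T}$ and with $\sigma=1/(\gamma T)$ are the Bachelier models. That is: (1) In every semilinear model with these data, $\{\xi_{tT}\}_{0\le t\le T}$ is an $\{\mathcal{F}_t\}$-Brownian motion and $A_T=\gamma\xi_{TT}$ almost surely. A jointly measurable version of $\mathbb{E}[A_T\mid\xi_{sT}]$, $0\le s<T$, exists and, whichever version is used: $\{W_t\}_{0\le t<T}$ is an $\{\mathcal{F}_t\}$-Brownian motion (adapted up to null sets); almost surely $W_t=\xi_{tT}$ for all $t\in[0,T)$; $\mathbb{E}[A_T\mid\mathcal{F}_t]=\gamma W_t$ almost surely for each $t\in[0,T)$; almost surely, for all $t\in[0,T)$ and $x\in\mathbb{R}$, $$f_{tT}(x)=f^B_{tT}(x):=\frac{\exp\left[-\frac12\frac{1}{\gamma^2(T-t)}(x-\gamma W_t)^2\right]}{\int_{-\infty}^{\infty}\exp\left[-\frac12\frac{1}{\gamma^2(T-t)}(y-\gamma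 W_t)^2\right]dy},$$ the Gaussian density with mean $\gamma W_t$ and variance $\gamma^2(T-t)$; $f_{tT}$ is the conditional density of $A_T$ given $\mathcal{F}_t$; and $f_{tT}$ is almost surely continuous in $t$, is normalised, $y\mapsto\sigma_{tT}(y)f_{tT}(y)$ is almost surely integrable for all $t\in[0,T)$, and, for each $x$ and each $t\in[0,T)$, almost surely $$f_{tT}(x)=f_{0T}(x)+\int_0^t\left[\sigma_{sT}(x)-\int_{\mathbb{R}}\sigma_{sT}(y)f_{sT}(y)\,dy\right]f_{sT}(x)\,dW_s .$$ (2) Conversely, let $\{B_t\}_{0\le t\le T}$ be a Brownian motion on $(\Omega,\mathcal{F},\mathbb{Q})$ (with respect to its own filtration). Then the Bachelier model $\gamma B$ is such a semilinear model: there are $A_T$ and $\{\beta_{tT}\}$ forming a semilinear model with the above $f_{0T}$ and $\sigma$ for which $A_T=\gamma B_T$ and $\xi_{tT}=B_t$ for all $t\in[0,T]$. -/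

import Mathlib

open MeasureTheory ProbabilityTheory Filter Topology Set

noncomputable section

namespace CondDensity

variable {Ω : Type*}

/-- The σ-algebra generated by the process `Y` up to time `t`, i.e. by `Y s` for `0 ≤ s ≤ t`. -/
abbrev pastSigma (Y : ℝ → Ω → ℝ) (t : ℝ) : MeasurableSpace Ω :=
  ⨆ s ∈ Icc (0 : ℝ) t, MeasurableSpace.comap (Y s) (inferInstance : MeasurableSpace ℝ)

variable [MeasurableSpace Ω]

/-- `W` is, over the time set `J` (an interval starting at `0`), a standard Brownian motion with
respect to the filtration `F`: adapted, started at `0`, with continuous paths, and with increments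
after `s` that are independent of `F s` and centred Gaussian with variance the elapsed time.
As usual for processes built from conditional expectations, which are only defined up to null sets,
adaptedness is understood modulo `Q`-null sets (equivalently, with respect to the
`Q`-completion of `F`). -/
structure IsBrownianMotionOn (J : Set ℝ) (F : ℝ → MeasurableSpace Ω) (W : ℝ → Ω → ℝ)
    (Q : Measure Ω) : Prop where
  adapted : ∀ t ∈ J, AEStronglyMeasurable[F t] (W t) Q
  start : ∀ᵐ ω ∂Q, W 0 ω = 0
  continuous : ∀ᵐ ω ∂Q, ContinuousOn (fun t => W t ω) J
  incr_indep : ∀ s ∈ J, ∀ t ∈ J, s ≤ t →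
    Indep (MeasurableSpace.comap (fun ω => W t ω - W s ω) inferInstance) (F s) Q
  incr_law : ∀ s ∈ J, ∀ t ∈ J, s ≤ t →
    HasLaw (fun ω => W t ω - W s ω) (gaussianReal 0 (t - s).toNNReal) Q

/-- `β` is a standard Brownian bridge over `[0, T]` (from `0` to `0`): a continuous centred Gaussian
process with covariance `s (T - t) / T` for `s ≤ t`. -/
structure IsBrownianBridge (T : ℝ) (β : ℝ → Ω → ℝ) (Q : Measure Ω) : Prop where
  measurable : ∀ t ∈ Icc 0 T, Measurable (β t)
  gaussian : IsGaussianProcess (fun t : Icc (0 : ℝ) T => β t) Q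
  mean : ∀ t ∈ Icc 0 T, ∫ ω, β t ω ∂Q = 0
  covariance : ∀ s ∈ Icc 0 T, ∀ t ∈ Icc 0 T, s ≤ t → cov[β s, β t; Q] = s * (T - t) / T
  continuous : ∀ᵐ ω ∂Q, ContinuousOn (fun t => β t ω) (Icc 0 T)

/-! ### Itô integral of square-integrable integrands -/

/-- An elementary process on `[0, t]`: `∑ i < n, coef i * 1_{(time i, time (i+1)]}` with bounded
coefficients, `coef i` being `F (time i)`-measurable. -/
structure ElementaryProcess (F : ℝ → MeasurableSpace Ω) (t : ℝ) where
  n : ℕ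
  time : ℕ → ℝ
  time_mono : Monotone time
  time_mem : ∀ i, time i ∈ Icc 0 t
  coef : ℕ → Ω → ℝ
  coef_measurable : ∀ i, Measurable[F (time i)] (coef i)
  coef_bounded : ∀ i, ∃ C : ℝ, ∀ ω, |coef i ω| ≤ C

/-- The value of an elementary process at time `s`. -/
def ElementaryProcess.eval {F : ℝ → MeasurableSpace Ω} {t : ℝ} (e : ElementaryProcess F t)
    (s : ℝ) (ω : Ω) : ℝ :=
  ∑ i ∈ Finset.range e.n, (Ioc (e.time i) (e.time (i + 1))).indicator (fun _ => e.coef i ω) s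

/-- The stochastic integral over `[0, t]` of an elementary process with respect to `W`. -/
def ElementaryProcess.integral {F : ℝ → MeasurableSpace Ω} {t : ℝ} (e : ElementaryProcess F t)
    (W : ℝ → Ω → ℝ) (ω : Ω) : ℝ :=
  ∑ i ∈ Finset.range e.n, e.coef i ω * (W (e.time (i + 1)) ω - W (e.time i) ω)

/-- `J` is the Itô integral `∫₀ᵗ H_s dW_s` of the integrand `H ∈ L²([0, t] × Ω)`: there are
elementary processes converging to `H` in `L²([0, t] × Ω)` whose integrals converge to `J` in
`L²(Ω)`. When `W` is an `F`-Brownian motion, `J` does not depend on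
the approximating sequence, by the Itô isometry. -/
def IsItoIntegral (Q : Measure Ω) (F : ℝ → MeasurableSpace Ω) (W : ℝ → Ω → ℝ) (t : ℝ)
    (H : ℝ → Ω → ℝ) (J : Ω → ℝ) : Prop :=
  MemLp (fun p : ℝ × Ω => H p.1 p.2) 2 ((volume.restrict (Icc 0 t)).prod Q) ∧
  MemLp J 2 Q ∧
  ∃ e : ℕ → ElementaryProcess F t,
    Tendsto (fun k => eLpNorm (fun p : ℝ × Ω => H p.1 p.2 - (e k).eval p.1 p.2) 2
      ((volume.restrict (Icc 0 t)).prod Q)) atTop (𝓝 0) ∧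
    Tendsto (fun k => eLpNorm (fun ω => J ω - (e k).integral W ω) 2 Q) atTop (𝓝 0)

/-! ### The master equation -/

/-- The process of densities `f t ω x`, `0 ≤ t < T`, solves the master equation
`f_t(x) = f₀(x) + ∫₀ᵗ (v_s(x) - ∫ v_s(y) f_s(y) dy) f_s(x) dW_s`
with initial density `f₀` and (deterministic) volatility structure `v`; it is continuous in time
and satisfies the normalisation condition. -/
structure SolvesMasterEquation (Q : Measure Ω) (F : ℝ → MeasurableSpace Ω) (W : ℝ → Ω → ℝ)
    (T : ℝ) (f₀ : ℝ → ℝ) (v : ℝ → ℝ → ℝ) (f : ℝ → Ω → ℝ → ℝ) : Prop where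
  continuous : ∀ᵐ ω ∂Q, ∀ x, ContinuousOn (fun t => f t ω x) (Ico 0 T)
  normalized : ∀ᵐ ω ∂Q, ∀ t ∈ Ico 0 T, Integrable (f t ω) ∧ ∫ x, f t ω x = 1
  integrable : ∀ᵐ ω ∂Q, ∀ t ∈ Ico 0 T, Integrable (fun y => v t y * f t ω y)
  equation : ∀ x, ∀ t ∈ Ico 0 T,
    IsItoIntegral Q F W t (fun s ω => (v s x - ∫ y, v s y * f s ω y) * f s ω x)
      (fun ω => f t ω x - f₀ x)

/-! ### The semilinear models -/

/-- The data of a semilinear model: a random variable `A` (the terminal value `A_T`) with prescribed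
density `f₀`, and an independent standard Brownian bridge `β` over `[0, T]`. -/
structure IsSemilinearModel (Q : Measure Ω) (T : ℝ) (f₀ : ℝ → ℝ) (A : Ω → ℝ)
    (β : ℝ → Ω → ℝ) : Prop where
  density_measurable : Measurable f₀
  density_nonneg : ∀ x, 0 ≤ f₀ x
  terminal_measurable : Measurable A
  terminal_law : Q.map A = volume.withDensity (fun x => ENNReal.ofReal (f₀ x))
  bridge : IsBrownianBridge T β Q
  indep : IndepFun A (fun ω (t : Icc (0 : ℝ) T) => β t ω) Q

/-- The information process `ξ_t = σ A t + β_t`. -/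
def infoProcess (σ : ℝ) (A : Ω → ℝ) (β : ℝ → Ω → ℝ) (t : ℝ) (ω : Ω) : ℝ :=
  σ * A ω * t + β t ω

/-- The semilinear volatility structure `σ T x / (T - t)`. -/
def semilinearVol (T σ t x : ℝ) : ℝ := σ * (T / (T - t)) * x

/-- `m` is a jointly measurable version of the process `E[A | ξ_s]`, `0 ≤ s < T`. -/
structure IsEstimate (Q : Measure Ω) (T : ℝ) (A : Ω → ℝ) (ξ : ℝ → Ω → ℝ)
    (m : ℝ → Ω → ℝ) : Prop where
  measurable : Measurable (Function.uncurry m)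
  ae_eq : ∀ s ∈ Ico 0 T, m s =ᵐ[Q] Q[A | MeasurableSpace.comap (ξ s) inferInstance]

/-- The driving process `W_t = ξ_t - ∫₀ᵗ (σ T E[A | ξ_s] - ξ_s) / (T - s) ds` of a semilinear
model, formed with a version `m` of `E[A | ξ_s]`. -/
def drivingProcess (T σ : ℝ) (ξ m : ℝ → Ω → ℝ) (t : ℝ) (ω : Ω) : ℝ :=
  ξ t ω - ∫ s in (0 : ℝ)..t, 1 / (T - s) * (σ * T * m s ω - ξ s ω)

/-- The density of a semilinear model at time `t`, when the information process is at `z`. -/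
def semilinearDensity (T σ : ℝ) (f₀ : ℝ → ℝ) (t z x : ℝ) : ℝ :=
  f₀ x * Real.exp (T / (T - t) * (σ * z * x - 1 / 2 * σ ^ 2 * x ^ 2 * t)) /
    ∫ y, f₀ y * Real.exp (T / (T - t) * (σ * z * y - 1 / 2 * σ ^ 2 * y ^ 2 * t))

/-! ### The Bachelier model -/

/-- The Bachelier conditional density at time `t`, when the Brownian motion is at `w`. -/
def bachelierDensity (T γ t w x : ℝ) : ℝ :=
  Real.exp (-(1 / 2) * (1 / (γ ^ 2 * (T - t))) * (x - γ * w) ^ 2) /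
    ∫ y, Real.exp (-(1 / 2) * (1 / (γ ^ 2 * (T - t))) * (y - γ * w) ^ 2)

/-- The centred Gaussian density with variance `1 / (T σ²)`. -/
def bachelierInitialDensity (T σ x : ℝ) : ℝ :=
  |σ| * √T / √(2 * Real.pi) * Real.exp (-(1 / 2) * σ ^ 2 * T * x ^ 2)

end CondDensity

end

/-!
The theorem rests on one covariance computation. If `A` is centred Gaussian with variance
`1 / (T σ²)` and independent of the bridge `β`, then `ξ t = σ A t + β t` is a centred Gaussian
process with covariance `s t / T + s (T - t) / T = s` for `s ≤ t`, hence a Brownian motion in its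
own filtration (`isBrownianMotionOn_pastSigma`, `IsSemilinearModel.isBrownianMotionOn`). As
`β T = 0` and `σ = 1 / (γ T)`, the terminal value is `A = γ ξ T`. Conversely, for a Brownian motion
`B` the variable `γ B T` and the bridge `B t - (t / T) B T` are jointly Gaussian and uncorrelated,
hence independent (`IsBrownianMotionOn.isSemilinearModel`).

The increment `ξ T - ξ t` is independent of the past up to `t`, so the freezing lemma
`condExp_comp_prodMk_of_indep` gives both `E[A | ξ t] = E[A | F t] = γ ξ t` and the conditional law
`N(γ ξ t, γ² (T - t))` of `A`. Thus the drift of the driving process vanishes and `W = ξ` almost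
surely, whichever version of the estimate is used (`drivingProcess_eq`). Completing the square
identifies the density of the semilinear model with that of the conditional law.

For the master equation, the density at `x` is `u t (ξ t)`, where `u` solves the backward heat
equation and its space derivative `h` is the integrand. The stochastic integral of `h s (ξ s)` is
the `L²` limit of the sums `∑ h (t i) (ξ (t i)) (ξ (t (i + 1)) - ξ (t i))` over the subdivision of
`[0, t]` into `N` equal pieces: by the semigroup property the errors
`u (t (i + 1)) (ξ (t (i + 1))) - u (t i) (ξ (t i)) - h (t i) (ξ (t i)) (ξ (t (i + 1)) - ξ (t i))`
are martingale differences, hence orthogonal, and by Taylor's formula each has second moment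
`O(1 / N²)`, so that their sum has second moment `O(1 / N)` (`IsHeatPotential.isItoIntegral`).
-/

namespace CondDensity

/-! ### Conditioning and independence of the past -/

section Independence

variable {Ω : Type*} [mΩ : MeasurableSpace Ω]

/-- The freezing lemma: if `X` is `m`-measurable and `Y` is independent of `m`, then conditioning
`g (X, Y)` on `m` amounts to integrating out `Y` with `X` held fixed. -/
lemma condExp_comp_prodMk_of_indep {Ω E : Type*} [MeasurableSpace E] {m mΩ : MeasurableSpace Ω}
    {Q : Measure Ω} [IsProbabilityMeasure Q] (hm : m ≤ mΩ) {X : Ω → E} {Y : Ω → ℝ}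
    (hX : Measurable[m] X) (hY : AEMeasurable Y Q)
    (hind : Indep (MeasurableSpace.comap Y inferInstance) m Q)
    {g : E × ℝ → ℝ} (hg : Measurable g) (hint : Integrable (fun ω => g (X ω, Y ω)) Q) :
    Q[fun ω => g (X ω, Y ω) | m] =ᵐ[Q] fun ω => ∫ y, g (X ω, y) ∂(Q.map Y) := by
  have : IsProbabilityMeasure (Q.map Y) := Measure.isProbabilityMeasure_map hY
  have hX' : Measurable X := hX.mono hm le_rfl
  -- the joint law of `X`, restricted to an event of `m`, and `Y` is a product
  have key : ∀ G, MeasurableSet[m] G →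
      (Q.restrict G).map (fun ω => (X ω, Y ω)) = ((Q.restrict G).map X).prod (Q.map Y) := by
    intro G hG
    refine (Measure.prod_eq fun s t hs ht => ?_).symm
    rw [Measure.map_apply_of_aemeasurable (hX'.aemeasurable.prodMk hY.restrict) (hs.prod ht),
      Measure.restrict_apply' (hm _ hG), Measure.map_apply hX' hs,
      Measure.map_apply_of_aemeasurable hY ht, Measure.restrict_apply (hX' hs)]
    have h := (Indep_iff _ _ _).1 hind (Y ⁻¹' t) (X ⁻¹' s ∩ G) ⟨t, ht, rfl⟩
      (@MeasurableSet.inter _ m _ _ (hX hs) hG)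
    rw [mul_comm, ← h]
    congr 1
    ext ω
    simp only [mem_inter_iff, mem_preimage, mem_prod]
    tauto
  have hpair : AEMeasurable (fun ω => (X ω, Y ω)) Q := hX'.aemeasurable.prodMk hY
  have hgG : ∀ G, MeasurableSet[m] G →
      Integrable g (((Q.restrict G).map X).prod (Q.map Y)) := by
    intro G hG
    rw [← key G hG, integrable_map_measure hg.aestronglyMeasurable
      (hX'.aemeasurable.prodMk hY.restrict)]
    exact hint.restrict
  have hfm : Measurable fun x : E => ∫ y, g (x, y) ∂(Q.map Y) :=
    (hg.stronglyMeasurable.integral_prod_right').measurable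
  have hfi : Integrable (fun ω => ∫ y, g (X ω, y) ∂(Q.map Y)) Q := by
    have h := (hgG univ MeasurableSet.univ).integral_prod_left
    rw [Measure.restrict_univ] at h
    exact h.comp_measurable hX'
  refine (ae_eq_condExp_of_forall_setIntegral_eq hm hint (fun s _ _ => hfi.integrableOn)
    (fun G hG _ => ?_) (g := fun ω => ∫ y, g (X ω, y) ∂(Q.map Y))
    (hfm.comp hX).stronglyMeasurable.aestronglyMeasurable).symm
  have h1 : ∫ ω in G, g (X ω, Y ω) ∂Q
      = ∫ p, g p ∂((Q.restrict G).map (fun ω => (X ω, Y ω))) :=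
    (integral_map (hX'.aemeasurable.prodMk hY.restrict) hg.aestronglyMeasurable).symm
  rw [h1, key G hG, integral_prod _ (hgG G hG),
    integral_map hX'.aemeasurable hfm.aestronglyMeasurable]

/-- Random variables are independent as soon as each one is independent of a past containing all
its predecessors. -/
lemma iIndepFun_of_indep_past {ι E : Type*} [LinearOrder ι] [MeasurableSpace E] {Q : Measure Ω}
    [IsProbabilityMeasure Q] {X : ι → Ω → E} {F : ι → MeasurableSpace Ω}
    (hX : ∀ i j, i < j → Measurable[F j] (X i))
    (hind : ∀ j, Indep (MeasurableSpace.comap (X j) inferInstance) (F j) Q) :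
    iIndepFun X Q := by
  rw [iIndepFun_iff_measure_inter_preimage_eq_mul]
  intro S sets hsets
  induction S using Finset.induction_on_max with
  | empty => simp
  | insert a S ha ih =>
    have haS : a ∉ S := fun h => lt_irrefl _ (ha a h)
    rw [Finset.set_biInter_insert, Finset.prod_insert haS,
      ← ih fun i hi => hsets i (Finset.mem_insert_of_mem hi)]
    refine (Indep_iff _ _ _).1 (hind a) _ _ ⟨_, hsets a (Finset.mem_insert_self _ _), rfl⟩ ?_
    exact Finset.measurableSet_biInter _ fun i hi =>
      hX i a (ha i hi) (hsets i (Finset.mem_insert_of_mem hi))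

end Independence

/-! ### Brownian motion as a Gaussian process -/

section GaussianBrownian

lemma measurable_pastSigma {Ω : Type*} (ξ : ℝ → Ω → ℝ) {s t : ℝ} (hs : s ∈ Icc 0 t) :
    Measurable[pastSigma ξ t] (ξ s) :=
  measurable_iff_comap_le.2
    (le_iSup₂ (f := fun s (_ : s ∈ Icc (0 : ℝ) t) =>
      MeasurableSpace.comap (ξ s) (inferInstance : MeasurableSpace ℝ)) s hs)

lemma pastSigma_mono {Ω : Type*} (ξ : ℝ → Ω → ℝ) {s t : ℝ} (hst : s ≤ t) :
    pastSigma ξ s ≤ pastSigma ξ t :=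
  biSup_mono fun _ hu => ⟨hu.1, hu.2.trans hst⟩

variable {Ω : Type*} [mΩ : MeasurableSpace Ω] {Q : Measure Ω} {T : ℝ} {ξ : ℝ → Ω → ℝ}

lemma pastSigma_le (hξ : ∀ t ∈ Icc 0 T, Measurable (ξ t)) {t : ℝ} (ht : t ≤ T) :
    pastSigma ξ t ≤ mΩ :=
  iSup₂_le fun s hs => (hξ s ⟨hs.1, hs.2.trans ht⟩).comap_le

lemma ae_eq_zero_of_hasGaussianLaw [IsProbabilityMeasure Q] {X : Ω → ℝ} (hX : HasGaussianLaw X Q)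
    (hmean : ∫ ω, X ω ∂Q = 0) (hcov : cov[X, X; Q] = 0) : ∀ᵐ ω ∂Q, X ω = 0 := by
  have h := hX.map_eq_gaussianReal
  rw [hmean, ← covariance_self hX.aemeasurable, hcov, Real.toNNReal_zero,
    gaussianReal_zero_var] at h
  exact HasLaw.ae_eq_of_dirac ⟨hX.aemeasurable, h⟩

/-- A centred Gaussian process with the covariance of Brownian motion is a Brownian motion with
respect to the filtration it generates. -/
lemma isBrownianMotionOn_pastSigma [IsProbabilityMeasure Q] (hT : 0 ≤ T)
    (hξ : ∀ t ∈ Icc 0 T, Measurable (ξ t))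
    (hG : IsGaussianProcess (fun t : Icc (0 : ℝ) T => ξ t) Q)
    (hmean : ∀ t ∈ Icc 0 T, ∫ ω, ξ t ω ∂Q = 0)
    (hcov : ∀ s ∈ Icc 0 T, ∀ t ∈ Icc 0 T, s ≤ t → cov[ξ s, ξ t; Q] = s)
    (hcont : ∀ᵐ ω ∂Q, ContinuousOn (fun t => ξ t ω) (Icc 0 T)) :
    IsBrownianMotionOn (Icc 0 T) (pastSigma ξ) ξ Q := by
  have hL2 : ∀ t ∈ Icc 0 T, MemLp (ξ t) 2 Q := fun t ht =>
    (hG.hasGaussianLaw_eval ⟨t, ht⟩).memLp_two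
  have h0 : (0 : ℝ) ∈ Icc 0 T := ⟨le_rfl, hT⟩
  refine ⟨fun t ht => ?_, ?_, hcont, fun s hs t ht hst => ?_, fun s hs t ht hst => ?_⟩
  · exact (measurable_pastSigma ξ ⟨ht.1, le_rfl⟩).stronglyMeasurable.aestronglyMeasurable
  · exact ae_eq_zero_of_hasGaussianLaw (hG.hasGaussianLaw_eval ⟨0, h0⟩) (hmean 0 h0)
      (hcov 0 h0 0 h0 le_rfl)
  · have hjoint : IndepFun (fun ω (_ : Unit) => ξ t ω - ξ s ω)
        (fun ω (u : Icc (0 : ℝ) s) => ξ u ω) Q := by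
      have hsub : ∀ u : Icc (0 : ℝ) s, (u : ℝ) ∈ Icc 0 T := fun u => ⟨u.2.1, u.2.2.trans hs.2⟩
      apply IsGaussianProcess.indepFun_of_covariance_eq_zero
        (X := fun (_ : Unit) ω => ξ t ω - ξ s ω) (Y := fun (u : Icc (0 : ℝ) s) ω => ξ u ω)
      · classical
        apply hG.of_isGaussianProcess
        rintro (_ | u)
        · exact ⟨{⟨s, hs⟩, ⟨t, ht⟩},
            { toFun x := x ⟨⟨t, ht⟩, by simp⟩ - x ⟨⟨s, hs⟩, by simp⟩
              map_add' x y := by simp; ring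
              map_smul' c x := by simp; ring }, by simp⟩
        · exact ⟨{⟨u, hsub u⟩},
            { toFun x := x ⟨⟨u, hsub u⟩, by simp⟩
              map_add' x y := by simp
              map_smul' c x := by simp }, by simp⟩
      · exact fun _ => ((hξ t ht).sub (hξ s hs)).aemeasurable
      · exact fun u => (hξ u (hsub u)).aemeasurable
      · intro _ u
        rw [covariance_fun_sub_left (hL2 t ht) (hL2 s hs) (hL2 u (hsub u)), covariance_comm,
          covariance_comm (ξ s), hcov u (hsub u) t ht (u.2.2.trans hst),
          hcov u (hsub u) s hs u.2.2, sub_self]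
    have h1 : IndepFun (fun ω => ξ t ω - ξ s ω) (fun ω (u : Icc (0 : ℝ) s) => ξ u ω) Q :=
      hjoint.comp (φ := fun x : Unit → ℝ => x ()) (ψ := id) (by fun_prop) measurable_id
    refine indep_of_indep_of_le_right h1 (iSup₂_le fun u hu => ?_)
    have : ξ u = (fun x : Icc (0 : ℝ) s → ℝ => x ⟨u, hu⟩) ∘ fun ω (u : Icc (0 : ℝ) s) => ξ u ω :=
      rfl
    rw [this, ← MeasurableSpace.comap_comp]
    exact MeasurableSpace.comap_mono (measurable_pi_apply _).comap_le
  · have hd : MemLp (fun ω => ξ t ω - ξ s ω) 2 Q := (hL2 t ht).sub (hL2 s hs)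
    have hm : AEMeasurable (fun ω => ξ t ω - ξ s ω) Q := ((hξ t ht).sub (hξ s hs)).aemeasurable
    refine ⟨hm, ?_⟩
    have hg : HasGaussianLaw (fun ω => ξ t ω - ξ s ω) Q :=
      hG.hasGaussianLaw_fun_sub (s := ⟨t, ht⟩) (t := ⟨s, hs⟩)
    rw [hg.map_eq_gaussianReal]
    congr 1
    · rw [integral_sub ((hL2 t ht).integrable one_le_two) ((hL2 s hs).integrable one_le_two),
        hmean t ht, hmean s hs, sub_self]
    · congr 1
      rw [← covariance_self hm,  covariance_fun_sub_left (hL2 t ht) (hL2 s hs) hd,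
        covariance_fun_sub_right (hL2 t ht) (hL2 t ht) (hL2 s hs),
        covariance_fun_sub_right (hL2 s hs) (hL2 t ht) (hL2 s hs), hcov t ht t ht le_rfl,
        covariance_comm (ξ t), hcov s hs t ht hst, hcov s hs s hs le_rfl]
      ring

/-- The law of a Brownian motion at time `t`. -/
lemma IsBrownianMotionOn.hasLaw (hT : 0 ≤ T) {F : ℝ → MeasurableSpace Ω}
    (hξ : IsBrownianMotionOn (Icc 0 T) F ξ Q) {t : ℝ} (ht : t ∈ Icc 0 T) :
    HasLaw (ξ t) (gaussianReal 0 t.toNNReal) Q := by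
  have h := hξ.incr_law 0 ⟨le_rfl, hT⟩ t ht ht.1
  rw [sub_zero] at h
  refine h.congr ?_
  filter_upwards [hξ.start] with ω hω
  rw [hω, sub_zero]

/-- A Brownian motion has the covariance `min s t`. -/
lemma IsBrownianMotionOn.covariance [IsProbabilityMeasure Q] (hT : 0 ≤ T)
    (hξ : IsBrownianMotionOn (Icc 0 T) (pastSigma ξ) ξ Q)
    {s t : ℝ} (hs : s ∈ Icc 0 T) (ht : t ∈ Icc 0 T) (hst : s ≤ t) : cov[ξ s, ξ t; Q] = s := by
  have hL2 : ∀ t ∈ Icc 0 T, MemLp (ξ t) 2 Q := fun t ht =>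
    (hξ.hasLaw hT ht).hasGaussianLaw.memLp_two
  have hd : MemLp (fun ω => ξ t ω - ξ s ω) 2 Q := (hL2 t ht).sub (hL2 s hs)
  have hind : IndepFun (ξ s) (fun ω => ξ t ω - ξ s ω) Q :=
    indep_of_indep_of_le_left (hξ.incr_indep s hs t ht hst).symm
      (measurable_iff_comap_le.1 (measurable_pastSigma ξ ⟨hs.1, le_rfl⟩))
  have h2 : ξ t = (fun ω => ξ t ω - ξ s ω) + ξ s := by ext ω; simp
  rw [h2, covariance_add_right (hL2 s hs) hd (hL2 s hs),
    hind.covariance_eq_zero (hL2 s hs) hd,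
    covariance_self (hL2 s hs).aestronglyMeasurable.aemeasurable,
    (hξ.hasLaw hT hs).variance_eq, variance_id_gaussianReal, zero_add, Real.coe_toNNReal _ hs.1]

/-- A Brownian motion with respect to the filtration it generates is a Gaussian process. -/
lemma IsBrownianMotionOn.isGaussianProcess [IsProbabilityMeasure Q] (hT : 0 ≤ T)
    (hξ : IsBrownianMotionOn (Icc 0 T) (pastSigma ξ) ξ Q) :
    IsGaussianProcess (fun t : Icc (0 : ℝ) T => ξ t) Q := by
  have : Fact ((0 : ℝ) ≤ T) := ⟨hT⟩
  refine HasIndepIncrements.isGaussianProcess (fun t => (hξ.hasLaw hT t.2).hasGaussianLaw)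
    hξ.start fun n τ hτ => ?_
  refine iIndepFun_of_indep_past (F := fun i => pastSigma ξ (τ i.castSucc)) (fun i j hij => ?_)
    fun j => hξ.incr_indep _ (τ _).2 _ (τ _).2 (hτ (Fin.castSucc_le_succ j))
  have h1 : (τ i.succ : ℝ) ≤ τ j.castSucc := hτ (Fin.succ_le_castSucc_iff.2 hij)
  have h2 : (τ i.castSucc : ℝ) ≤ τ j.castSucc := hτ (Fin.castSucc_le_castSucc_iff.2 hij.le)
  exact (measurable_pastSigma ξ ⟨(τ _).2.1, h1⟩).sub (measurable_pastSigma ξ ⟨(τ _).2.1, h2⟩)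

end GaussianBrownian

/-! ### Taylor remainders along a Brownian path -/

section Remainder

variable {Ω : Type*} [mΩ : MeasurableSpace Ω] {Q : Measure Ω} {T : ℝ} {ξ : ℝ → Ω → ℝ}

/-- Square-integrable martingale differences are orthogonal, so the second moment of their sum is
at most the sum of bounds for their second moments. -/
lemma integral_sq_sum_le_of_condExp_eq_zero [IsProbabilityMeasure Q] {G : ℕ → MeasurableSpace Ω}
    (hG : Monotone G) (hle : ∀ i, G i ≤ mΩ) {R : ℕ → Ω → ℝ}
    (hR : ∀ i, Measurable[G (i + 1)] (R i)) (hL2 : ∀ i, MemLp (R i) 2 Q)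
    (hzero : ∀ i, Q[R i | G i] =ᵐ[Q] 0) {c : ℝ} (hc : ∀ i, ∫ ω, R i ω ^ 2 ∂Q ≤ c) (n : ℕ) :
    MemLp (fun ω => ∑ i ∈ Finset.range n, R i ω) 2 Q ∧
      ∫ ω, (∑ i ∈ Finset.range n, R i ω) ^ 2 ∂Q ≤ n * c := by
  have hsum : ∀ n, MemLp (fun ω => ∑ i ∈ Finset.range n, R i ω) 2 Q := fun n =>
    memLp_finsetSum _ fun i _ => hL2 i
  refine ⟨hsum n, ?_⟩
  induction n with
  | zero => simp
  | succ n ih =>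
    set S : Ω → ℝ := fun ω => ∑ i ∈ Finset.range n, R i ω with hS
    have hSm : Measurable[G n] S :=
      Finset.measurable_fun_sum _ fun i hi => (hR i).mono (hG (Finset.mem_range.1 hi)) le_rfl
    have hint : Integrable (S * R n) Q := (hsum n).integrable_mul (hL2 n)
    have hcross : ∫ ω, S ω * R n ω ∂Q = 0 := by
      have h1 := condExp_mul_of_stronglyMeasurable_left (μ := Q) hSm.stronglyMeasurable hint
        ((hL2 n).integrable one_le_two)
      have h2 : Q[S * R n | G n] =ᵐ[Q] 0 := by
        filter_upwards [h1, hzero n] with ω h1 h2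
        rw [h1, Pi.mul_apply, h2, Pi.zero_apply, mul_zero]
      calc ∫ ω, S ω * R n ω ∂Q = ∫ ω, (Q[S * R n | G n]) ω ∂Q := (integral_condExp (hle n)).symm
        _ = 0 := by rw [integral_congr_ae h2]; simp
    have hexp : ∀ ω, (∑ i ∈ Finset.range (n + 1), R i ω) ^ 2
        = S ω ^ 2 + 2 * (S ω * R n ω) + R n ω ^ 2 := fun ω => by
      rw [Finset.sum_range_succ, hS]; ring
    have hSi : Integrable (fun ω => S ω ^ 2) Q := (hsum n).integrable_sq
    have hci : Integrable (fun ω => 2 * (S ω * R n ω)) Q := hint.const_mul 2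
    have hSc : Integrable (fun ω => S ω ^ 2 + 2 * (S ω * R n ω)) Q := hSi.add hci
    simp_rw [hexp]
    rw [integral_add hSc (hL2 n).integrable_sq, integral_add hSi hci, integral_const_mul, hcross]
    push_cast
    linarith [hc n]

/-- `u` is, over the time interval `[0, t]`, a bounded solution of the backward heat equation in
integrated form (`semigroup`), with space derivative `h` and the error estimate of a Taylor
expansion to first order in time and second order in space, all with the constant `C`. -/
structure IsHeatPotential (t C : ℝ) (u h : ℝ → ℝ → ℝ) : Prop where
  measurable : ∀ s ∈ Icc 0 t, Measurable (u s)
  bound : ∀ s ∈ Icc 0 t, ∀ z, |u s z| ≤ C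
  deriv_bound : ∀ s ∈ Icc 0 t, ∀ z, |h s z| ≤ C
  deriv_continuous : ContinuousOn (Function.uncurry h) (Icc 0 t ×ˢ univ)
  taylor : ∀ s ∈ Icc 0 t, ∀ s' ∈ Icc 0 t, ∀ z z',
    |u s' z' - u s z - h s z * (z' - z)| ≤ C * (|s' - s| + (z' - z) ^ 2)
  semigroup : ∀ s ∈ Icc 0 t, ∀ s' ∈ Icc 0 t, s ≤ s' → ∀ z,
    ∫ y, u s' (z + y) ∂(gaussianReal 0 (s' - s).toNNReal) = u s z

lemma IsHeatPotential.deriv_measurable {t C : ℝ} {u h : ℝ → ℝ → ℝ} (hu : IsHeatPotential t C u h)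
    {s : ℝ} (hs : s ∈ Icc 0 t) : Measurable (h s) := by
  refine Continuous.measurable (continuousOn_univ.1 ?_)
  exact hu.deriv_continuous.comp (f := fun z => (s, z)) (by fun_prop) fun z _ => ⟨hs, mem_univ _⟩

lemma integral_pow_four_gaussianReal {δ : ℝ} (hδ : 0 ≤ δ) :
    ∫ y, y ^ 4 ∂(gaussianReal 0 δ.toNNReal) = δ ^ 2 * ∫ y, y ^ 4 ∂(gaussianReal 0 1) := by
  have h : gaussianReal 0 δ.toNNReal = (gaussianReal 0 1).map (√δ * ·) := by
    rw [gaussianReal_map_const_mul, mul_zero, mul_one]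
    congr 1
    ext
    simp [hδ]
  rw [h, integral_map (by fun_prop) (by fun_prop), ← integral_const_mul]
  congr 1 with y
  rw [mul_pow, show √δ ^ 4 = (√δ ^ 2) ^ 2 by ring, Real.sq_sqrt hδ]

/-- The error of replacing, over the time step from `s` to `s'`, the increment of `u` along the
path of `ξ` by its linear part. -/
def taylorRemainder {Ω : Type*} (u h : ℝ → ℝ → ℝ) (ξ : ℝ → Ω → ℝ) (s s' : ℝ) (ω : Ω) : ℝ :=
  u s' (ξ s' ω) - u s (ξ s ω) - h s (ξ s ω) * (ξ s' ω - ξ s ω)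

section Step

variable {t C : ℝ} {u h : ℝ → ℝ → ℝ} {s s' : ℝ}

lemma IsHeatPotential.measurable_taylorRemainder {Ω : Type*} {ξ : ℝ → Ω → ℝ}
    (hu : IsHeatPotential t C u h)
    (hs : s ∈ Icc 0 t) (hs' : s' ∈ Icc 0 t) (hss' : s ≤ s') :
    Measurable[pastSigma ξ s'] (taylorRemainder u h ξ s s') := by
  have h1 := measurable_pastSigma ξ (t := s') ⟨hs.1, hss'⟩
  have h2 := measurable_pastSigma ξ (t := s') ⟨hs'.1, le_rfl⟩
  exact (((hu.measurable s' hs').comp h2).sub ((hu.measurable s hs).comp h1)).sub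
    (((hu.deriv_measurable hs).comp h1).mul (h2.sub h1))

/-- The second moment of the remainder is quadratic in the length of the time step, because the
fourth moment of a Brownian increment is. -/
lemma IsHeatPotential.memLp_taylorRemainder [IsProbabilityMeasure Q]
    (hu : IsHeatPotential t C u h) (htT : t ≤ T) (hm : ∀ t ∈ Icc 0 T, Measurable (ξ t))
    (hξ : IsBrownianMotionOn (Icc 0 T) (pastSigma ξ) ξ Q)
    (hs : s ∈ Icc 0 t) (hs' : s' ∈ Icc 0 t) (hss' : s ≤ s') :
    MemLp (taylorRemainder u h ξ s s') 2 Q ∧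
      ∫ ω, taylorRemainder u h ξ s s' ω ^ 2 ∂Q
        ≤ 2 * C ^ 2 * (1 + ∫ y, y ^ 4 ∂(gaussianReal 0 1)) * (s' - s) ^ 2 := by
  have hsT : s ∈ Icc 0 T := ⟨hs.1, hs.2.trans htT⟩
  have hsT' : s' ∈ Icc 0 T := ⟨hs'.1, hs'.2.trans htT⟩
  have hδ : 0 ≤ s' - s := sub_nonneg.2 hss'
  have hlaw := hξ.incr_law s hsT s' hsT' hss'
  have hmeas : Measurable (taylorRemainder u h ξ s s') :=
    (hu.measurable_taylorRemainder hs hs' hss').mono (pastSigma_le hm hsT'.2) le_rfl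
  have h4' : Integrable (fun y : ℝ => y ^ 4) (gaussianReal 0 (s' - s).toNNReal) := by
    have h := (memLp_id_gaussianReal (μ := 0) (v := (s' - s).toNNReal) 4).integrable_norm_pow
      (p := 4) (by norm_num)
    refine h.congr (ae_of_all _ fun y => ?_)
    simp only [id, Real.norm_eq_abs]
    rw [Even.pow_abs ⟨2, rfl⟩]
  have h4 : Integrable (fun ω => (ξ s' ω - ξ s ω) ^ 4) Q := by
    rw [← hlaw.map_eq] at h4'
    exact h4'.comp_aemeasurable hlaw.aemeasurable
  have hle : ∀ ω, taylorRemainder u h ξ s s' ω ^ 2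
      ≤ 2 * C ^ 2 * ((s' - s) ^ 2 + (ξ s' ω - ξ s ω) ^ 4) := fun ω => by
    have h1 := hu.taylor s hs s' hs' (ξ s ω) (ξ s' ω)
    rw [abs_of_nonneg hδ] at h1
    have h2 := pow_le_pow_left₀ (abs_nonneg _) h1 2
    rw [sq_abs] at h2
    refine h2.trans ?_
    rw [mul_pow, mul_comm 2, mul_assoc]
    refine mul_le_mul_of_nonneg_left ?_ (sq_nonneg C)
    nlinarith [sq_nonneg ((s' - s) - (ξ s' ω - ξ s ω) ^ 2)]
  have hbound : Integrable (fun ω => 2 * C ^ 2 * ((s' - s) ^ 2 + (ξ s' ω - ξ s ω) ^ 4)) Q :=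
    ((integrable_const _).add h4).const_mul _
  have hint : Integrable (fun ω => taylorRemainder u h ξ s s' ω ^ 2) Q := by
    refine hbound.mono' (hmeas.pow_const 2).aestronglyMeasurable (ae_of_all _ fun ω => ?_)
    rw [Real.norm_of_nonneg (sq_nonneg _)]
    exact hle ω
  refine ⟨(memLp_two_iff_integrable_sq hmeas.aestronglyMeasurable).2 hint, ?_⟩
  refine (integral_mono hint hbound hle).trans (le_of_eq ?_)
  have hmom := hlaw.integral_comp (f := fun y : ℝ => y ^ 4) (by fun_prop)
  simp only [Function.comp_def] at hmom
  rw [integral_const_mul, integral_add (integrable_const _) h4, integral_const, hmom,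
    integral_pow_four_gaussianReal hδ]
  simp
  ring

/-- The remainders are martingale differences: by the semigroup property the conditional expectation
of `u s' (ξ s')` is `u s (ξ s)`, and the linear part is centred. -/
lemma IsHeatPotential.condExp_taylorRemainder [IsProbabilityMeasure Q]
    (hu : IsHeatPotential t C u h) (htT : t ≤ T) (hm : ∀ t ∈ Icc 0 T, Measurable (ξ t))
    (hξ : IsBrownianMotionOn (Icc 0 T) (pastSigma ξ) ξ Q)
    (hs : s ∈ Icc 0 t) (hs' : s' ∈ Icc 0 t) (hss' : s ≤ s') :
    Q[taylorRemainder u h ξ s s' | pastSigma ξ s] =ᵐ[Q] 0 := by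
  have hsT : s ∈ Icc 0 T := ⟨hs.1, hs.2.trans htT⟩
  have hsT' : s' ∈ Icc 0 T := ⟨hs'.1, hs'.2.trans htT⟩
  have hlaw := hξ.incr_law s hsT s' hsT' hss'
  let g : ℝ × ℝ → ℝ := fun p => u s' (p.1 + p.2) - u s p.1 - h s p.1 * p.2
  have hg : Measurable g :=
    (((hu.measurable s' hs').comp (by fun_prop)).sub ((hu.measurable s hs).comp (by fun_prop))).sub
      (((hu.deriv_measurable hs).comp (by fun_prop)).mul (by fun_prop))
  have hgR : (fun ω => g (ξ s ω, ξ s' ω - ξ s ω)) = taylorRemainder u h ξ s s' := by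
    ext ω
    simp [g, taylorRemainder]
  have hint := ((hu.memLp_taylorRemainder htT hm hξ hs hs' hss').1).integrable one_le_two
  rw [← hgR] at hint ⊢
  refine (condExp_comp_prodMk_of_indep (pastSigma_le hm hsT.2)
    (measurable_pastSigma ξ ⟨hs.1, le_rfl⟩) hlaw.aemeasurable
    (hξ.incr_indep s hsT s' hsT' hss') hg hint).trans (ae_of_all _ fun ω => ?_)
  rw [hlaw.map_eq]
  have hid : Integrable (fun y : ℝ => y) (gaussianReal 0 (s' - s).toNNReal) :=
    (memLp_id_gaussianReal 1).integrable le_rfl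
  have hus : Integrable (fun y => u s' (ξ s ω + y)) (gaussianReal 0 (s' - s).toNNReal) :=
    Integrable.of_bound
      ((hu.measurable s' hs').comp (measurable_const_add _)).aestronglyMeasurable C
      (ae_of_all _ fun y => hu.bound s' hs' _)
  have hus' : Integrable (fun y => u s' (ξ s ω + y) - u s (ξ s ω))
      (gaussianReal 0 (s' - s).toNNReal) := hus.sub (integrable_const _)
  simp only [g]
  rw [integral_sub hus' (hid.const_mul _),
    integral_sub hus (integrable_const _), hu.semigroup s hs s' hs' hss', integral_const_mul,
    integral_id_gaussianReal]
  simp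

end Step

end Remainder

/-! ### Itô's formula for heat potentials -/

section Ito

/-- The `i`-th point of the subdivision of `[0, t]` into `N` equal pieces, constant from `i = N`
on. -/
noncomputable def gridTime (t : ℝ) (N i : ℕ) : ℝ := t * ((min i N : ℕ) / (N : ℝ))

lemma gridTime_mono {t : ℝ} (ht : 0 ≤ t) (N : ℕ) : Monotone (gridTime t N) := by
  intro i j hij
  unfold gridTime
  gcongr

lemma gridTime_mem {t : ℝ} (ht : 0 ≤ t) (N i : ℕ) : gridTime t N i ∈ Icc 0 t := by
  refine ⟨by unfold gridTime; positivity, mul_le_of_le_one_right ht ?_⟩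
  exact div_le_one_of_le₀ (by exact_mod_cast min_le_right i N) (Nat.cast_nonneg N)

lemma gridTime_zero (t : ℝ) (N : ℕ) : gridTime t N 0 = 0 := by simp [gridTime]

lemma gridTime_self (t : ℝ) {N : ℕ} (hN : N ≠ 0) : gridTime t N N = t := by
  have : (N : ℝ) ≠ 0 := Nat.cast_ne_zero.2 hN
  simp [gridTime, this]

lemma gridTime_succ_sub_le {t : ℝ} (ht : 0 ≤ t) (N i : ℕ) :
    gridTime t N (i + 1) - gridTime t N i ≤ t / N := by
  have h : ((min (i + 1) N : ℕ) : ℝ) ≤ (min i N : ℕ) + 1 := by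
    exact_mod_cast (by omega : min (i + 1) N ≤ min i N + 1)
  unfold gridTime
  rw [← mul_sub, ← sub_div, div_eq_mul_one_div t]
  gcongr
  linarith

/-- Each time in `(0, t]` lies in a cell of the subdivision. -/
lemma exists_mem_Ioc_gridTime {t s : ℝ} {N : ℕ} (hN : N ≠ 0) (hs : s ∈ Ioc 0 t) :
    ∃ i < N, s ∈ Ioc (gridTime t N i) (gridTime t N (i + 1)) := by
  have hex : ∃ i, s ≤ gridTime t N i := ⟨N, by rw [gridTime_self t hN]; exact hs.2⟩
  classical
  have hspec := Nat.find_spec hex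
  have hpos : Nat.find hex ≠ 0 := fun h => by
    rw [h, gridTime_zero] at hspec
    exact absurd hs.1 (not_lt.2 hspec)
  obtain ⟨i, hi⟩ := Nat.exists_eq_succ_of_ne_zero hpos
  have hlt : ¬ s ≤ gridTime t N i := Nat.find_min hex (by omega)
  refine ⟨i, ?_, not_le.1 hlt, by rwa [hi] at hspec⟩
  have : Nat.find hex ≤ N := Nat.find_min' hex (by rw [gridTime_self t hN]; exact hs.2)
  omega

variable {Ω : Type*} [mΩ : MeasurableSpace Ω] {Q : Measure Ω} {T t C : ℝ} {ξ : ℝ → Ω → ℝ}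
  {u h : ℝ → ℝ → ℝ}

/-- The elementary process freezing the integrand `h s (ξ s)` at the left end points of the
subdivision of `[0, t]` into `N` equal pieces. -/
noncomputable def IsHeatPotential.elementary (hu : IsHeatPotential t C u h) (ht : 0 ≤ t)
    (ξ : ℝ → Ω → ℝ) (N : ℕ) : ElementaryProcess (pastSigma ξ) t where
  n := N
  time := gridTime t N
  time_mono := gridTime_mono ht N
  time_mem := gridTime_mem ht N
  coef i ω := h (gridTime t N i) (ξ (gridTime t N i) ω)
  coef_measurable i := (hu.deriv_measurable (gridTime_mem ht N i)).comp
    (measurable_pastSigma ξ ⟨(gridTime_mem ht N i).1, le_rfl⟩)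
  coef_bounded i := ⟨C, fun _ => hu.deriv_bound _ (gridTime_mem ht N i) _⟩

/-- The value of the elementary process at a time of the `i`-th cell. -/
lemma ElementaryProcess.eval_of_mem {Ω : Type*} {F : ℝ → MeasurableSpace Ω}
    (e : ElementaryProcess F t) {i : ℕ} (hi : i < e.n) {s : ℝ}
    (hs : s ∈ Ioc (e.time i) (e.time (i + 1))) (ω : Ω) :
    e.eval s ω = e.coef i ω := by
  unfold ElementaryProcess.eval
  rw [Finset.sum_eq_single i]
  · exact indicator_of_mem hs _
  · intro j _ hji
    refine indicator_of_notMem (fun hj => ?_) _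
    rcases lt_or_gt_of_ne hji with h | h
    · exact absurd (hs.1.trans_le hj.2) (not_lt.2 (e.time_mono h))
    · exact absurd (hj.1.trans_le hs.2) (not_lt.2 (e.time_mono h))
  · exact fun h => absurd (Finset.mem_range.2 hi) h

lemma ElementaryProcess.measurable_eval {F : ℝ → MeasurableSpace Ω}
    (hF : ∀ s ∈ Icc 0 t, F s ≤ mΩ) (e : ElementaryProcess F t) :
    Measurable fun p : ℝ × Ω => e.eval p.1 p.2 := by
  unfold ElementaryProcess.eval
  refine Finset.measurable_fun_sum _ fun i _ => ?_
  have hc : Measurable fun p : ℝ × Ω => e.coef i p.2 :=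
    ((e.coef_measurable i).mono (hF _ (e.time_mem i)) le_rfl).comp measurable_snd
  exact (hc.indicator (measurable_fst measurableSet_Ioc) :)

/-- Convergence in `L²` on a finite measure space, for a uniformly bounded sequence converging
almost everywhere. -/
lemma tendsto_eLpNorm_two_of_bounded {α : Type*} [MeasurableSpace α] {μ : Measure α}
    [IsFiniteMeasure μ] {f : ℕ → α → ℝ} {g : α → ℝ} {B : ℝ}
    (hf : ∀ k, AEStronglyMeasurable (f k) μ) (hg : AEStronglyMeasurable g μ)
    (hB : ∀ k, ∀ᵐ a ∂μ, |g a - f k a| ≤ B)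
    (hlim : ∀ᵐ a ∂μ, Tendsto (fun k => f k a) atTop (𝓝 (g a))) :
    Tendsto (fun k => eLpNorm (fun a => g a - f k a) 2 μ) atTop (𝓝 0) := by
  have h1 : Tendsto (fun k => ∫⁻ a, ‖g a - f k a‖ₑ ^ (2 : ℝ) ∂μ) atTop (𝓝 (∫⁻ _, 0 ∂μ)) := by
    refine tendsto_lintegral_of_dominated_convergence' (fun _ => ENNReal.ofReal B ^ (2 : ℝ))
      (fun k => (hg.sub (hf k)).enorm.pow_const _) (fun k => ?_) ?_ ?_
    · filter_upwards [hB k] with a ha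
      have : ‖g a - f k a‖ₑ ≤ ENNReal.ofReal B := by
        rw [Real.enorm_eq_ofReal_abs]
        exact ENNReal.ofReal_le_ofReal ha
      gcongr
    · rw [lintegral_const]
      exact ENNReal.mul_ne_top (by finiteness) (measure_ne_top _ _)
    · filter_upwards [hlim] with a ha
      have h : Tendsto (fun k => ‖g a - f k a‖ₑ) atTop (𝓝 0) := by
        have := (tendsto_const_nhds (x := g a)).sub ha
        rw [sub_self] at this
        simpa using this.enorm
      have := (ENNReal.continuous_rpow_const (y := (2 : ℝ))).tendsto 0 |>.comp h
      simpa [Function.comp_def] using this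
  have h2 := ((ENNReal.continuous_rpow_const (y := (1 / 2 : ℝ))).tendsto _).comp h1
  simp only [lintegral_zero, one_div, inv_pos, Nat.ofNat_pos, ENNReal.zero_rpow_of_pos] at h2
  refine h2.congr fun k => ?_
  rw [eLpNorm_eq_lintegral_rpow_enorm_toReal (by norm_num) (by norm_num)]
  simp

/-- **Itô's formula** for a heat potential along a Brownian motion `ξ`: the process `u s (ξ s)` is
the stochastic integral of its space derivative. -/
lemma IsHeatPotential.isItoIntegral [IsProbabilityMeasure Q] (hu : IsHeatPotential t C u h)
    (ht : t ∈ Icc 0 T) (hm : ∀ t ∈ Icc 0 T, Measurable (ξ t))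
    (hξ : IsBrownianMotionOn (Icc 0 T) (pastSigma ξ) ξ Q) :
    IsItoIntegral Q (pastSigma ξ) ξ t (fun s ω => h s (ξ s ω)) (fun ω => u t (ξ t ω) - u 0 0) := by
  have h0t : (0 : ℝ) ∈ Icc 0 t := ⟨le_rfl, ht.1⟩
  have htt : t ∈ Icc 0 t := ⟨ht.1, le_rfl⟩
  have hle : ∀ s ∈ Icc 0 t, pastSigma ξ s ≤ mΩ := fun s hs => pastSigma_le hm (hs.2.trans ht.2)
  set μ : Measure (ℝ × Ω) := (volume.restrict (Icc 0 t)).prod Q with hμ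
  let e : ℕ → ElementaryProcess (pastSigma ξ) t := fun k => hu.elementary ht.1 ξ (k + 1)
  have hem : ∀ k, AEStronglyMeasurable (fun p : ℝ × Ω => (e k).eval p.1 p.2) μ := fun k =>
    ((e k).measurable_eval hle).aestronglyMeasurable
  -- almost every time lies in `(0, t]`, and almost every path is continuous
  have hae : ∀ᵐ p ∂μ, p.1 ∈ Ioc 0 t ∧ ContinuousOn (fun s => ξ s p.2) (Icc 0 T) := by
    have h1 : ∀ᵐ s ∂(volume.restrict (Icc 0 t)), s ∈ Ioc 0 t := by
      rw [← restrict_Ioc_eq_restrict_Icc]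
      exact ae_restrict_mem measurableSet_Ioc
    exact (Measure.quasiMeasurePreserving_fst.ae h1).and
      (Measure.quasiMeasurePreserving_snd.ae hξ.continuous)
  have heval : ∀ k : ℕ, ∀ s ∈ Ioc 0 t, ∃ r ∈ Icc 0 t, |r - s| ≤ t / ((k : ℝ) + 1) ∧
      ∀ ω, (e k).eval s ω = h r (ξ r ω) := by
    intro k s hs
    obtain ⟨i, hi, hsi⟩ := exists_mem_Ioc_gridTime k.succ_ne_zero hs
    refine ⟨gridTime t (k + 1) i, gridTime_mem ht.1 _ _, ?_, fun ω => (e k).eval_of_mem hi hsi ω⟩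
    have h1 := gridTime_succ_sub_le ht.1 (k + 1) i
    push_cast at h1
    rw [abs_sub_comm, abs_of_pos (sub_pos.2 hsi.1)]
    linarith [hsi.2]
  have hlim : ∀ᵐ p ∂μ, Tendsto (fun k => (e k).eval p.1 p.2) atTop (𝓝 (h p.1 (ξ p.1 p.2))) := by
    filter_upwards [hae] with p hp
    choose r hr hrs hre using fun k => heval k p.1 hp.1
    simp_rw [hre]
    have hs : p.1 ∈ Icc 0 t := ⟨hp.1.1.le, hp.1.2⟩
    have hrlim : Tendsto r atTop (𝓝[Icc 0 t] p.1) := by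
      refine tendsto_nhdsWithin_iff.2 ⟨?_, Eventually.of_forall hr⟩
      rw [tendsto_iff_dist_tendsto_zero]
      refine squeeze_zero (fun _ => dist_nonneg) hrs ?_
      have h := tendsto_one_div_add_atTop_nhds_zero_nat (𝕜 := ℝ) |>.const_mul t
      simpa [div_eq_mul_inv] using h
    have hcomp : ContinuousOn (fun s => h s (ξ s p.2)) (Icc 0 t) :=
      hu.deriv_continuous.comp (f := fun s => (s, ξ s p.2))
        (continuousOn_id.prodMk (hp.2.mono (Icc_subset_Icc_right ht.2)))
        fun s hs => ⟨hs, mem_univ _⟩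
    exact (hcomp p.1 hs).tendsto.comp hrlim
  have hHm : AEStronglyMeasurable (fun p : ℝ × Ω => h p.1 (ξ p.1 p.2)) μ :=
    aestronglyMeasurable_of_tendsto_ae atTop hem hlim
  refine ⟨?_, ?_, e, ?_, ?_⟩
  · refine MemLp.of_bound hHm C ?_
    filter_upwards [hae] with p hp
    exact hu.deriv_bound _ ⟨hp.1.1.le, hp.1.2⟩ _
  · refine MemLp.of_bound
      (((hu.measurable t htt).comp (hm t ht)).sub_const _).aestronglyMeasurable (C + C)
      (ae_of_all _ fun ω => ?_)
    exact (abs_sub _ _).trans (add_le_add (hu.bound t htt _) (hu.bound 0 h0t _))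
  · refine tendsto_eLpNorm_two_of_bounded (B := C + C) hem hHm (fun k => ?_) hlim
    filter_upwards [hae] with p hp
    obtain ⟨r, hr, -, hre⟩ := heval k p.1 hp.1
    rw [hre]
    exact (abs_sub _ _).trans
      (add_le_add (hu.deriv_bound _ ⟨hp.1.1.le, hp.1.2⟩ _) (hu.deriv_bound _ hr _))
  · set K : ℝ := 2 * C ^ 2 * (1 + ∫ y, y ^ 4 ∂(gaussianReal 0 1)) with hK
    have hK0 : 0 ≤ K := by
      have : 0 ≤ ∫ y, y ^ 4 ∂(gaussianReal 0 1) := integral_nonneg fun y => by positivity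
      positivity
    have hsq : ∀ k : ℕ, eLpNorm (fun ω => u t (ξ t ω) - u 0 0 - (e k).integral ξ ω) 2 Q
        ≤ ENNReal.ofReal (√(K * t ^ 2 / ((k : ℝ) + 1))) := by
      intro k
      set τ := gridTime t (k + 1) with hτ
      have hτm : ∀ i, τ i ∈ Icc 0 t := gridTime_mem ht.1 _
      have hτs : ∀ i, τ i ≤ τ (i + 1) := fun i => gridTime_mono ht.1 _ (Nat.le_succ i)
      have hsum := integral_sq_sum_le_of_condExp_eq_zero (Q := Q)
        (G := fun i => pastSigma ξ (τ i)) (R := fun i => taylorRemainder u h ξ (τ i) (τ (i + 1)))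
        (c := K * (t / ((k : ℝ) + 1)) ^ 2)
        (fun i j hij => pastSigma_mono ξ (gridTime_mono ht.1 _ hij)) (fun i => hle _ (hτm i))
        (fun i => hu.measurable_taylorRemainder (hτm i) (hτm (i + 1)) (hτs i))
        (fun i => (hu.memLp_taylorRemainder ht.2 hm hξ (hτm i) (hτm (i + 1)) (hτs i)).1)
        (fun i => hu.condExp_taylorRemainder ht.2 hm hξ (hτm i) (hτm (i + 1)) (hτs i))
        (fun i => by
          refine (hu.memLp_taylorRemainder ht.2 hm hξ (hτm i) (hτm (i + 1)) (hτs i)).2.trans ?_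
          have h1 := gridTime_succ_sub_le ht.1 (k + 1) i
          push_cast at h1
          exact mul_le_mul_of_nonneg_left
            (pow_le_pow_left₀ (sub_nonneg.2 (hτs i)) h1 2) hK0) (k + 1)
      -- the increments of `u` along the path telescope, starting from `ξ 0 = 0`
      have heq : (fun ω => u t (ξ t ω) - u 0 0 - (e k).integral ξ ω) =ᵐ[Q]
          fun ω => ∑ i ∈ Finset.range (k + 1), taylorRemainder u h ξ (τ i) (τ (i + 1)) ω := by
        filter_upwards [hξ.start] with ω hω
        have htel := Finset.sum_range_sub (fun i => u (τ i) (ξ (τ i) ω)) (k + 1)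
        rw [hτ, gridTime_self t k.succ_ne_zero, gridTime_zero, hω] at htel
        simp only [taylorRemainder]
        rw [Finset.sum_sub_distrib, hτ, htel]
        rfl
      rw [eLpNorm_congr_ae heq,
        hsum.1.eLpNorm_eq_integral_rpow_norm (by norm_num) (by norm_num)]
      refine ENNReal.ofReal_le_ofReal ?_
      rw [Real.sqrt_eq_rpow]
      simp only [ENNReal.toReal_ofNat, Real.rpow_ofNat, Real.norm_eq_abs, sq_abs, one_div]
      refine Real.rpow_le_rpow (integral_nonneg fun ω => sq_nonneg _) (hsum.2.trans (le_of_eq ?_))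
        (by norm_num)
      push_cast
      field_simp
    refine tendsto_of_tendsto_of_tendsto_of_le_of_le tendsto_const_nhds ?_
      (fun _ => zero_le) hsq
    have h1 : Tendsto (fun k : ℕ => K * t ^ 2 / ((k : ℝ) + 1)) atTop (𝓝 0) := by
      have h := tendsto_one_div_add_atTop_nhds_zero_nat (𝕜 := ℝ) |>.const_mul (K * t ^ 2)
      simpa [div_eq_mul_inv] using h
    have h2 := (ENNReal.continuous_ofReal.comp Real.continuous_sqrt).tendsto 0 |>.comp h1
    simpa [Function.comp_def] using h2

/-- The stochastic integral does not change if the integrator and the integrand are modified on a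
null event. -/
lemma IsItoIntegral.congr {F : ℝ → MeasurableSpace Ω} {W W' H H' : ℝ → Ω → ℝ} {J : Ω → ℝ}
    [SFinite Q] (hJ : IsItoIntegral Q F W t H J)
    (hW : ∀ᵐ ω ∂Q, ∀ s ∈ Icc 0 t, W s ω = W' s ω) (hH : ∀ᵐ ω ∂Q, ∀ s ∈ Icc 0 t, H s ω = H' s ω)
    {J' : Ω → ℝ} (hJJ' : J =ᵐ[Q] J') : IsItoIntegral Q F W' t H' J' := by
  obtain ⟨h1, h2, e, h3, h4⟩ := hJ
  have hHp : ∀ᵐ p ∂((volume.restrict (Icc 0 t)).prod Q), H p.1 p.2 = H' p.1 p.2 := by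
    filter_upwards [Measure.quasiMeasurePreserving_fst.ae (ae_restrict_mem measurableSet_Icc),
      Measure.quasiMeasurePreserving_snd.ae hH] with p hp1 hp2
    exact hp2 _ hp1
  refine ⟨h1.ae_eq hHp, h2.ae_eq hJJ', e, h3.congr fun k => eLpNorm_congr_ae ?_,
    h4.congr fun k => eLpNorm_congr_ae ?_⟩
  · filter_upwards [hHp] with p hp
    rw [hp]
  · filter_upwards [hW, hJJ'] with ω hω hJω
    rw [hJω]
    congr 1
    refine Finset.sum_congr rfl fun i _ => ?_
    rw [hω _ (e k |>.time_mem _), hω _ (e k |>.time_mem _)]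

end Ito

/-! ### The heat kernel -/

section HeatKernel

lemma gaussianPDFReal_toNNReal {m v : ℝ} (hv : 0 ≤ v) (x : ℝ) :
    gaussianPDFReal m v.toNNReal x
      = (√(2 * Real.pi * v))⁻¹ * Real.exp (-(x - m) ^ 2 / (2 * v)) := by
  rw [gaussianPDFReal_def, Real.coe_toNNReal _ hv]

/-- The centred Gaussian density `(2πv)^{-1/2} exp (-b² / (2v))`, as a function of the variance `v`
and the point `b`. -/
noncomputable def heatKernel (v b : ℝ) : ℝ :=
  (√(2 * Real.pi * v))⁻¹ * Real.exp (-b ^ 2 / (2 * v))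

lemma heatKernel_nonneg (v b : ℝ) : 0 ≤ heatKernel v b := by
  unfold heatKernel; positivity

/-- The Chapman-Kolmogorov equation for the heat kernel. -/
lemma integral_heatKernel_sub {v w : ℝ} (hv : 0 < v) (hw : 0 ≤ w) (b c : ℝ) :
    ∫ y, heatKernel v (b - c * y) ∂(gaussianReal 0 w.toNNReal) = heatKernel (v + c ^ 2 * w) b := by
  rcases hw.eq_or_lt with rfl | hw
  · simp [gaussianReal_zero_var]
  have hvw : 0 < v + c ^ 2 * w := by positivity
  have hw0 : w.toNNReal ≠ 0 := by simpa using hw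
  rw [integral_gaussianReal_eq_integral_smul hw0]
  -- completing the square in `y`
  have hsquare : ∀ y, gaussianPDFReal 0 w.toNNReal y • heatKernel v (b - c * y)
      = heatKernel (v + c ^ 2 * w) b *
        gaussianPDFReal (b * c * w / (v + c ^ 2 * w)) (v * w / (v + c ^ 2 * w)).toNNReal y := by
    intro y
    rw [gaussianPDFReal_toNNReal hw.le, gaussianPDFReal_toNNReal (by positivity), heatKernel,
      heatKernel, smul_eq_mul]
    have hs : √(2 * Real.pi * w) * √(2 * Real.pi * v)
        = √(2 * Real.pi * (v + c ^ 2 * w)) * √(2 * Real.pi * (v * w / (v + c ^ 2 * w))) := by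
      rw [← Real.sqrt_mul (by positivity), ← Real.sqrt_mul (by positivity)]
      congr 1
      field_simp
    have he : Real.exp (-(y - 0) ^ 2 / (2 * w)) * Real.exp (-(b - c * y) ^ 2 / (2 * v))
        = Real.exp (-b ^ 2 / (2 * (v + c ^ 2 * w))) *
          Real.exp (-(y - b * c * w / (v + c ^ 2 * w)) ^ 2 / (2 * (v * w / (v + c ^ 2 * w)))) := by
      rw [← Real.exp_add, ← Real.exp_add]
      congr 1
      field_simp
      ring
    rw [mul_mul_mul_comm, mul_mul_mul_comm (√(2 * Real.pi * (v + c ^ 2 * w)))⁻¹, ← mul_inv,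
      ← mul_inv, hs, he]
  simp_rw [hsquare]
  rw [integral_const_mul, integral_gaussianPDFReal_eq_one _ (by simpa using by positivity), mul_one]

lemma hasDerivAt_heatKernel {v : ℝ} (b : ℝ) :
    HasDerivAt (heatKernel v) (-(b / v) * heatKernel v b) b := by
  have h : HasDerivAt (fun b : ℝ => -b ^ 2 / (2 * v)) (-(2 * b) / (2 * v)) b := by
    have := ((hasDerivAt_pow 2 b).neg).div_const (2 * v)
    simpa using this
  refine (h.exp.const_mul (√(2 * Real.pi * v))⁻¹).congr_deriv ?_
  unfold heatKernel
  rw [neg_div (2 * v) (2 * b), mul_div_mul_left _ _ two_ne_zero]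
  ring

lemma hasDerivAt_deriv_heatKernel {v : ℝ} (b : ℝ) :
    HasDerivAt (fun b => -(b / v) * heatKernel v b)
      ((b ^ 2 / v - 1) / v * heatKernel v b) b := by
  have h : HasDerivAt (fun b : ℝ => -(b / v)) (-(1 / v)) b := ((hasDerivAt_id b).div_const v).neg
  refine (h.mul (hasDerivAt_heatKernel b)).congr_deriv ?_
  ring

/-- The heat equation. -/
lemma hasDerivAt_heatKernel_time {v : ℝ} (hv : 0 < v) (b : ℝ) :
    HasDerivAt (fun v => heatKernel v b) ((b ^ 2 / v - 1) / v * heatKernel v b / 2) v := by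
  have h2 : 0 < 2 * Real.pi * v := by positivity
  have h1 : HasDerivAt (fun v : ℝ => 2 * Real.pi * v) (2 * Real.pi) v := by
    simpa using (hasDerivAt_id v).const_mul (2 * Real.pi)
  have hsq := (h1.sqrt h2.ne').inv (Real.sqrt_pos.2 h2).ne'
  have hexp : HasDerivAt (fun v : ℝ => -b ^ 2 / (2 * v)) (b ^ 2 / (2 * v ^ 2)) v := by
    have := (((hasDerivAt_id v).const_mul 2).inv (by simpa using hv.ne')).const_mul (-b ^ 2)
    refine (this.congr_deriv ?_).congr_of_eventuallyEq (Eventually.of_forall fun x => ?_)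
    · simp only [id]
      field_simp
    · simp [div_eq_mul_inv]
  refine (hsq.mul hexp.exp).congr_deriv ?_
  unfold heatKernel
  have hs := Real.sq_sqrt h2.le
  have hs0 := (Real.sqrt_pos.2 h2).ne'
  simp only [Pi.inv_apply]
  rw [hs]
  field_simp
  ring

section Bounds

variable {v₀ v : ℝ}

lemma heatKernel_le (hv₀ : 0 < v₀) (hv : v₀ ≤ v) (b : ℝ) :
    heatKernel v b ≤ (√(2 * Real.pi * v₀))⁻¹ := by
  have hvp : 0 < v := hv₀.trans_le hv
  unfold heatKernel
  have h1 : Real.exp (-b ^ 2 / (2 * v)) ≤ 1 :=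
    Real.exp_le_one_iff.2
      (div_nonpos_of_nonpos_of_nonneg (neg_nonpos.2 (sq_nonneg b)) (by positivity))
  calc _ ≤ (√(2 * Real.pi * v))⁻¹ * 1 := by gcongr
    _ ≤ _ := by rw [mul_one]; gcongr

lemma sq_div_mul_heatKernel_le (hv₀ : 0 < v₀) (hv : v₀ ≤ v) (b : ℝ) :
    b ^ 2 / v * heatKernel v b ≤ 2 * (√(2 * Real.pi * v₀))⁻¹ := by
  have hvp : 0 < v := hv₀.trans_le hv
  have h1 : b ^ 2 / (2 * v) * Real.exp (-b ^ 2 / (2 * v)) ≤ 1 := by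
    rw [neg_div, Real.exp_neg, ← div_eq_mul_inv, div_le_one (Real.exp_pos _)]
    linarith [Real.add_one_le_exp (b ^ 2 / (2 * v))]
  have h2 : b ^ 2 / v * heatKernel v b
      = 2 * ((√(2 * Real.pi * v))⁻¹ * (b ^ 2 / (2 * v) * Real.exp (-b ^ 2 / (2 * v)))) := by
    unfold heatKernel
    field_simp
  rw [h2]
  refine mul_le_mul_of_nonneg_left ?_ (by norm_num)
  calc _ ≤ (√(2 * Real.pi * v))⁻¹ * 1 := by gcongr
    _ ≤ _ := by rw [mul_one]; gcongr

lemma abs_deriv_heatKernel_le (hv₀ : 0 < v₀) (hv : v₀ ≤ v) (b : ℝ) :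
    |b / v * heatKernel v b| ≤ (1 / v₀ + 2) * (√(2 * Real.pi * v₀))⁻¹ := by
  have hvp : 0 < v := hv₀.trans_le hv
  have hk := heatKernel_nonneg v b
  rw [abs_mul, abs_of_nonneg hk, abs_div, abs_of_pos hvp]
  have h1 : |b| / v ≤ 1 / v + b ^ 2 / v := by
    rw [← add_div]
    gcongr
    nlinarith [sq_abs b, sq_nonneg (|b| - 1)]
  calc |b| / v * heatKernel v b ≤ (1 / v + b ^ 2 / v) * heatKernel v b := by gcongr
    _ = 1 / v * heatKernel v b + b ^ 2 / v * heatKernel v b := by ring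
    _ ≤ 1 / v₀ * (√(2 * Real.pi * v₀))⁻¹ + 2 * (√(2 * Real.pi * v₀))⁻¹ := by
        refine add_le_add ?_ (sq_div_mul_heatKernel_le hv₀ hv b)
        have := heatKernel_le hv₀ hv b
        gcongr
    _ = _ := by ring

lemma abs_deriv_deriv_heatKernel_le (hv₀ : 0 < v₀) (hv : v₀ ≤ v) (b : ℝ) :
    |(b ^ 2 / v - 1) / v * heatKernel v b| ≤ 3 / v₀ * (√(2 * Real.pi * v₀))⁻¹ := by
  have hvp : 0 < v := hv₀.trans_le hv
  have hk := heatKernel_nonneg v b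
  have h1 := heatKernel_le hv₀ hv b
  have h2 := sq_div_mul_heatKernel_le hv₀ hv b
  have h3 : 0 ≤ b ^ 2 / v * heatKernel v b := by positivity
  have h4 : |(b ^ 2 / v - 1) * heatKernel v b| ≤ 3 * (√(2 * Real.pi * v₀))⁻¹ := by
    rw [abs_le]
    constructor <;> nlinarith
  calc |(b ^ 2 / v - 1) / v * heatKernel v b|
      = 1 / v * |(b ^ 2 / v - 1) * heatKernel v b| := by
        rw [show (b ^ 2 / v - 1) / v * heatKernel v b
          = 1 / v * ((b ^ 2 / v - 1) * heatKernel v b) by ring, abs_mul,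
          abs_of_pos (one_div_pos.2 hvp)]
    _ ≤ 1 / v₀ * (3 * (√(2 * Real.pi * v₀))⁻¹) := by gcongr
    _ = _ := by ring

lemma abs_heatKernel_sub_time_le (hv₀ : 0 < v₀) {v' : ℝ} (hv : v₀ ≤ v) (hv' : v₀ ≤ v') (b : ℝ) :
    |heatKernel v' b - heatKernel v b| ≤ 3 / v₀ * (√(2 * Real.pi * v₀))⁻¹ * |v' - v| := by
  refine (convex_Ici v₀).norm_image_sub_le_of_norm_hasDerivWithin_le
    (f := fun v => heatKernel v b)
    (fun x hx => (hasDerivAt_heatKernel_time (hv₀.trans_le hx) b).hasDerivWithinAt)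
    (fun x hx => ?_) hv hv'
  have h := abs_deriv_deriv_heatKernel_le hv₀ hx b
  rw [Real.norm_eq_abs, abs_div, abs_of_pos (zero_lt_two' ℝ)]
  linarith [abs_nonneg ((b ^ 2 / x - 1) / x * heatKernel x b)]

/-- Taylor's formula to the second order in space. -/
lemma abs_heatKernel_sub_le (hv₀ : 0 < v₀) (hv : v₀ ≤ v) (b b' : ℝ) :
    |heatKernel v b' - heatKernel v b + b / v * heatKernel v b * (b' - b)|
      ≤ 3 / v₀ * (√(2 * Real.pi * v₀))⁻¹ * (b' - b) ^ 2 := by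
  set M := 3 / v₀ * (√(2 * Real.pi * v₀))⁻¹ with hM
  have hM0 : 0 ≤ M := by positivity
  have hlip : ∀ y, |-(y / v) * heatKernel v y - -(b / v) * heatKernel v b| ≤ M * |y - b| := fun y =>
    convex_univ.norm_image_sub_le_of_norm_hasDerivWithin_le
      (f := fun b => -(b / v) * heatKernel v b)
      (fun x _ => (hasDerivAt_deriv_heatKernel x).hasDerivWithinAt)
      (fun x _ => abs_deriv_deriv_heatKernel_le hv₀ hv x) (mem_univ b) (mem_univ y)
  have h := (convex_uIcc b b').norm_image_sub_le_of_norm_hasDerivWithin_le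
    (f := fun y => heatKernel v y + b / v * heatKernel v b * y)
    (f' := fun y => -(y / v) * heatKernel v y + b / v * heatKernel v b) (C := M * |b' - b|)
    (fun x _ => by
      have := (hasDerivAt_id x).const_mul (b / v * heatKernel v b)
      rw [mul_one] at this
      exact ((hasDerivAt_heatKernel x).add this).hasDerivWithinAt)
    (fun x hx => by
      have h1 := hlip x
      rw [neg_mul (b / v), sub_neg_eq_add] at h1
      exact h1.trans (mul_le_mul_of_nonneg_left (abs_sub_left_of_mem_uIcc hx) hM0))
    left_mem_uIcc right_mem_uIcc
  rw [Real.norm_eq_abs, Real.norm_eq_abs, mul_assoc M, abs_mul_abs_self, ← sq] at h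
  convert h using 2
  ring

end Bounds

/-- The Gaussian density at `x` with mean `γ z` and variance `γ² (T - s)`, as a function of `s`
and `z`, is a heat potential up to any time `t < T`; the variance then stays away from `0`. -/
lemma exists_isHeatPotential_heatKernel {T γ t : ℝ} (hγ : γ ≠ 0) (ht : t < T) (x : ℝ) :
    ∃ C, IsHeatPotential t C (fun s z => heatKernel (γ ^ 2 * (T - s)) (x - γ * z))
      (fun s z => (x - γ * z) / (γ * (T - s)) * heatKernel (γ ^ 2 * (T - s)) (x - γ * z)) := by
  have hγ2 : 0 < γ ^ 2 := by positivity
  set v₀ := γ ^ 2 * (T - t) with hv₀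
  have hv₀p : 0 < v₀ := mul_pos hγ2 (sub_pos.2 ht)
  have hv : ∀ s ∈ Icc 0 t, v₀ ≤ γ ^ 2 * (T - s) := fun s hs => by
    rw [hv₀]; gcongr; exact hs.2
  set A := (√(2 * Real.pi * v₀))⁻¹ with hA
  have hA0 : 0 ≤ A := by positivity
  have hv₀inv : 0 ≤ 1 / v₀ := by positivity
  set M := 3 / v₀ * A with hM
  have hM0 : 0 ≤ M := by positivity
  set D := (1 / v₀ + 2) * A with hD
  have hD0 : 0 ≤ D := by positivity
  have hTs : ∀ s ∈ Icc 0 t, T - s ≠ 0 := fun s hs => (sub_pos.2 (hs.2.trans_lt ht)).ne'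
  -- the space derivative of the potential, by the chain rule
  have hh : ∀ s ∈ Icc 0 t, ∀ z, (x - γ * z) / (γ * (T - s)) *
      heatKernel (γ ^ 2 * (T - s)) (x - γ * z) = γ * ((x - γ * z) / (γ ^ 2 * (T - s)) *
        heatKernel (γ ^ 2 * (T - s)) (x - γ * z)) := fun s hs z => by
    have := hTs s hs
    field_simp
  refine ⟨A + |γ| * D + γ ^ 2 * M, ?_, ?_, ?_, ?_, ?_, ?_⟩
  · intro s _
    unfold heatKernel
    fun_prop
  · intro s hs z
    rw [abs_of_nonneg (heatKernel_nonneg _ _)]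
    have := heatKernel_le hv₀p (hv s hs) (x - γ * z)
    have h2 : 0 ≤ |γ| * D + γ ^ 2 * M := by positivity
    linarith
  · intro s hs z
    rw [hh s hs, abs_mul]
    have := mul_le_mul_of_nonneg_left (abs_deriv_heatKernel_le hv₀p (hv s hs) (x - γ * z))
      (abs_nonneg γ)
    have h2 : 0 ≤ γ ^ 2 * M := by positivity
    linarith
  · have h1 : ContinuousOn (fun p : ℝ × ℝ => γ * (T - p.1)) (Icc 0 t ×ˢ univ) := by fun_prop
    have h2 : ContinuousOn (fun p : ℝ × ℝ => 2 * Real.pi * (γ ^ 2 * (T - p.1)))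
      (Icc 0 t ×ˢ univ) := by fun_prop
    have h3 : ContinuousOn (fun p : ℝ × ℝ => 2 * (γ ^ 2 * (T - p.1))) (Icc 0 t ×ˢ univ) := by
      fun_prop
    unfold heatKernel Function.uncurry
    refine (ContinuousOn.div (by fun_prop) h1 fun p hp => ?_).mul
      ((h2.sqrt.inv₀ fun p hp => ?_).mul
        (ContinuousOn.div (by fun_prop) h3 fun p hp => ?_).rexp)
    · exact mul_ne_zero hγ (hTs _ hp.1)
    · have := hv₀p.trans_le (hv _ hp.1)
      positivity
    · exact mul_ne_zero two_ne_zero (mul_ne_zero hγ2.ne' (hTs _ hp.1))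
  · intro s hs s' hs' z z'
    have h1 := abs_heatKernel_sub_time_le hv₀p (hv s hs) (hv s' hs') (x - γ * z')
    have h2 := abs_heatKernel_sub_le hv₀p (hv s hs) (x - γ * z) (x - γ * z')
    have e1 : |γ ^ 2 * (T - s') - γ ^ 2 * (T - s)| = γ ^ 2 * |s' - s| := by
      rw [← mul_sub, abs_mul, abs_of_pos hγ2, ← abs_neg]
      congr 2
      ring
    have e2 : (x - γ * z' - (x - γ * z)) ^ 2 = γ ^ 2 * (z' - z) ^ 2 := by ring
    rw [e1] at h1
    rw [e2] at h2
    rw [hh s hs]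
    have h3 : 0 ≤ (A + |γ| * D) * (|s' - s| + (z' - z) ^ 2) := by positivity
    have h4 := abs_add_le
      (heatKernel (γ ^ 2 * (T - s')) (x - γ * z') - heatKernel (γ ^ 2 * (T - s)) (x - γ * z'))
      (heatKernel (γ ^ 2 * (T - s)) (x - γ * z') - heatKernel (γ ^ 2 * (T - s)) (x - γ * z) +
        (x - γ * z) / (γ ^ 2 * (T - s)) * heatKernel (γ ^ 2 * (T - s)) (x - γ * z) *
          (x - γ * z' - (x - γ * z)))
    have h5 : (A + |γ| * D + γ ^ 2 * M) * (|s' - s| + (z' - z) ^ 2)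
        = (A + |γ| * D) * (|s' - s| + (z' - z) ^ 2) + M * (γ ^ 2 * |s' - s|)
          + M * (γ ^ 2 * (z' - z) ^ 2) := by ring
    refine le_trans (le_of_eq ?_) (h4.trans (by linarith))
    congr 1
    ring
  · intro s hs s' hs' hss' z
    have h := integral_heatKernel_sub (hv₀p.trans_le (hv s' hs')) (sub_nonneg.2 hss')
      (x - γ * z) γ
    rw [show γ ^ 2 * (T - s') + γ ^ 2 * (s' - s) = γ ^ 2 * (T - s) by ring] at h
    rw [← h]
    congr 1 with y
    congr 1
    ring

end HeatKernel

/-! ### Gaussian conditional densities and the information process -/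

section Density

lemma gaussianPDFReal_eq_heatKernel {m v : ℝ} (hv : 0 ≤ v) (x : ℝ) :
    gaussianPDFReal m v.toNNReal x = heatKernel v (x - m) :=
  gaussianPDFReal_toNNReal hv x

lemma bachelierInitialDensity_eq {T σ : ℝ} (hT : 0 < T) (hσ : σ ≠ 0) (x : ℝ) :
    bachelierInitialDensity T σ x = gaussianPDFReal 0 (1 / (T * σ ^ 2)).toNNReal x := by
  have hv : 0 < 1 / (T * σ ^ 2) := by positivity
  rw [gaussianPDFReal_toNNReal hv.le, bachelierInitialDensity]
  congr 1
  · rw [mul_one_div, Real.sqrt_div (by positivity), Real.sqrt_mul hT.le, Real.sqrt_sq_eq_abs,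
      inv_div, mul_comm]
  · congr 1
    field_simp
    ring

/-- Normalising a multiple of a Gaussian density gives back the Gaussian density. -/
lemma div_integral_eq_gaussianPDFReal {m v c : ℝ} (hv : 0 < v) (hc : c ≠ 0) {g : ℝ → ℝ}
    (hg : ∀ x, g x = c * gaussianPDFReal m v.toNNReal x) (x : ℝ) :
    g x / ∫ y, g y = gaussianPDFReal m v.toNNReal x := by
  simp_rw [hg]
  rw [integral_const_mul, integral_gaussianPDFReal_eq_one _ (by simpa using hv), mul_one,
    mul_div_cancel_left₀ _ hc]

lemma bachelierDensity_eq {T γ t : ℝ} (hγ : γ ≠ 0) (ht : t < T) (w x : ℝ) :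
    bachelierDensity T γ t w x = gaussianPDFReal (γ * w) (γ ^ 2 * (T - t)).toNNReal x := by
  have hTt : 0 < T - t := sub_pos.2 ht
  have hv : 0 < γ ^ 2 * (T - t) := by positivity
  refine div_integral_eq_gaussianPDFReal
    (g := fun x => Real.exp (-(1 / 2) * (1 / (γ ^ 2 * (T - t))) * (x - γ * w) ^ 2)) hv
    (c := √(2 * Real.pi * (γ ^ 2 * (T - t)))) (by positivity) (fun x => ?_) x
  rw [gaussianPDFReal_toNNReal hv.le, mul_inv_cancel_left₀ (by positivity)]
  congr 1
  field_simp

lemma semilinearDensity_eq {T γ σ t : ℝ} (hT : 0 < T) (hγ : γ ≠ 0) (hσ : σ = 1 / (γ * T))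
    (ht : t < T) (z x : ℝ) :
    semilinearDensity T σ (bachelierInitialDensity T σ) t z x
      = gaussianPDFReal (γ * z) (γ ^ 2 * (T - t)).toNNReal x := by
  have hTt : 0 < T - t := sub_pos.2 ht
  have hv : 0 < γ ^ 2 * (T - t) := by positivity
  have hσ0 : σ ≠ 0 := by rw [hσ]; positivity
  refine div_integral_eq_gaussianPDFReal
    (g := fun x => bachelierInitialDensity T σ x *
      Real.exp (T / (T - t) * (σ * z * x - 1 / 2 * σ ^ 2 * x ^ 2 * t))) hv
    (c := |σ| * √T / √(2 * Real.pi) * √(2 * Real.pi * (γ ^ 2 * (T - t))) *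
      Real.exp (z ^ 2 / (2 * (T - t)))) (by positivity) (fun x => ?_) x
  -- completing the square in `x`
  have he : Real.exp (-(1 / 2) * σ ^ 2 * T * x ^ 2) *
        Real.exp (T / (T - t) * (σ * z * x - 1 / 2 * σ ^ 2 * x ^ 2 * t))
      = Real.exp (z ^ 2 / (2 * (T - t))) *
        Real.exp (-(x - γ * z) ^ 2 / (2 * (γ ^ 2 * (T - t)))) := by
    rw [← Real.exp_add, ← Real.exp_add, hσ]
    congr 1
    field_simp
    ring
  rw [gaussianPDFReal_toNNReal hv.le, bachelierInitialDensity, mul_assoc, he]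
  have hs : √(2 * Real.pi * (γ ^ 2 * (T - t))) ≠ 0 := by positivity
  field_simp

lemma integrable_mul_gaussianPDFReal (m : ℝ) {v : ℝ} (hv : 0 < v) :
    Integrable fun y => y * gaussianPDFReal m v.toNNReal y := by
  have h : Integrable (fun y : ℝ => y) (gaussianReal m v.toNNReal) :=
    (memLp_id_gaussianReal 1).integrable le_rfl
  rw [gaussianReal_of_var_ne_zero _ (by simpa using hv),
    integrable_withDensity_iff (measurable_gaussianPDF _ _)
      (ae_of_all _ fun _ => gaussianPDF_lt_top)] at h
  simpa only [toReal_gaussianPDF] using h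

lemma integral_mul_gaussianPDFReal (m : ℝ) {v : ℝ} (hv : 0 < v) :
    ∫ y, y * gaussianPDFReal m v.toNNReal y = m := by
  have h := integral_gaussianReal_eq_integral_smul (μ := m) (v := v.toNNReal) (f := fun y => y)
    (by simpa using hv)
  rw [integral_id_gaussianReal] at h
  simpa [mul_comm] using h.symm

variable {Ω : Type*} [mΩ : MeasurableSpace Ω] {Q : Measure Ω} {T γ σ : ℝ} {ξ : ℝ → Ω → ℝ}
  {A : Ω → ℝ} {β : ℝ → Ω → ℝ}

/-- A process with almost surely continuous paths has a jointly measurable modification, extended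
to all times by freezing it outside `[0, T]`. -/
lemma exists_measurable_modification (hT : 0 ≤ T) (hm : ∀ t ∈ Icc 0 T, Measurable (ξ t))
    (hcont : ∀ᵐ ω ∂Q, ContinuousOn (fun t => ξ t ω) (Icc 0 T)) :
    ∃ η : ℝ → Ω → ℝ, Measurable (Function.uncurry η) ∧
      ∀ᵐ ω ∂Q, ∀ t ∈ Icc 0 T, η t ω = ξ t ω := by
  classical
  set N := toMeasurable Q {ω | ¬ ContinuousOn (fun t => ξ t ω) (Icc 0 T)} with hN
  refine ⟨fun t ω => if ω ∈ N then 0 else ξ (projIcc 0 T hT t) ω, ?_, ?_⟩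
  · refine measurable_uncurry_of_continuous_of_measurable (fun ω => ?_) fun t => ?_
    · by_cases hω : ω ∈ N
      · simpa [hω] using continuous_const
      · have hc : ContinuousOn (fun t => ξ t ω) (Icc 0 T) := by
          by_contra h
          exact hω (subset_toMeasurable _ _ h)
        simpa [hω, Function.comp_def] using hc.domRestrict.comp continuous_projIcc
    · exact Measurable.ite (measurableSet_toMeasurable _ _) measurable_const
        (hm _ (projIcc 0 T hT t).2)
  · have h0 : Q N = 0 := by rw [hN, measure_toMeasurable]; exact hcont
    filter_upwards [measure_eq_zero_iff_ae_notMem.1 h0] with ω hω t ht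
    rw [if_neg hω, projIcc_of_mem hT ht]

/-- Being a Brownian motion is insensitive to modifications on a null event. -/
lemma IsBrownianMotionOn.congr {F : ℝ → MeasurableSpace Ω} {J J' : Set ℝ} {W : ℝ → Ω → ℝ}
    (hξ : IsBrownianMotionOn J F ξ Q) (hJ : J' ⊆ J) (h0 : (0 : ℝ) ∈ J')
    (hW : ∀ᵐ ω ∂Q, ∀ t ∈ J', W t ω = ξ t ω) : IsBrownianMotionOn J' F W Q := by
  have hWt : ∀ t ∈ J', ξ t =ᵐ[Q] W t := fun t ht => by
    filter_upwards [hW] with ω hω using (hω t ht).symm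
  have hinc : ∀ s ∈ J', ∀ t ∈ J',
      (fun ω => ξ t ω - ξ s ω) =ᵐ[Q] fun ω => W t ω - W s ω := fun s hs t ht =>
    (hWt t ht).sub (hWt s hs)
  refine ⟨fun t ht => (hξ.adapted t (hJ ht)).congr (hWt t ht), ?_, ?_, fun s hs t ht hst => ?_,
    fun s hs t ht hst => (hξ.incr_law s (hJ hs) t (hJ ht) hst).congr (hinc s hs t ht).symm⟩
  · filter_upwards [hW, hξ.start] with ω h1 h2
    rw [h1 0 h0, h2]
  · filter_upwards [hW, hξ.continuous] with ω h1 h2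
    exact (h2.mono hJ).congr fun t ht => h1 t ht
  · have h := hξ.incr_indep s (hJ hs) t (hJ ht) hst
    rw [Indep_iff] at h ⊢
    rintro _ G ⟨B, hB, rfl⟩ hG
    have hB' : ((fun ω => ξ t ω - ξ s ω) ⁻¹' B : Set Ω) =ᵐ[Q] (fun ω => W t ω - W s ω) ⁻¹' B :=
      (hinc s hs t ht).preimage B
    rw [← measure_congr hB', ← measure_congr (hB'.inter (ae_eq_refl G))]
    exact h _ G ⟨B, hB, rfl⟩ hG

section Terminal

variable [IsProbabilityMeasure Q]

/-- The best estimate of `γ ξ_T` is `γ ξ_t`, given any information between `ξ_t` and the past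
of `ξ` up to time `t`. -/
lemma condExp_terminal {Ω : Type*} {m mΩ : MeasurableSpace Ω} {Q : Measure Ω}
    [IsProbabilityMeasure Q] {ξ : ℝ → Ω → ℝ} {A : Ω → ℝ} (hm : ∀ t ∈ Icc 0 T, Measurable (ξ t))
    (hξ : IsBrownianMotionOn (Icc 0 T) (pastSigma ξ) ξ Q) (hA : ∀ᵐ ω ∂Q, A ω = γ * ξ T ω)
    {t : ℝ} (ht : t ∈ Icc 0 T) (hmF : m ≤ pastSigma ξ t)
    (hξm : Measurable[m] (ξ t)) : Q[A | m] =ᵐ[Q] fun ω => γ * ξ t ω := by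
  have hT : T ∈ Icc 0 T := ⟨ht.1.trans ht.2, le_rfl⟩
  have hlaw := hξ.incr_law t ht T hT ht.2
  have hid : Integrable (fun y : ℝ => y) (gaussianReal 0 (T - t).toNNReal) :=
    (memLp_id_gaussianReal 1).integrable le_rfl
  have hint : Integrable (fun ω => γ * (ξ t ω + (ξ T ω - ξ t ω))) Q := by
    simp only [add_sub_cancel]
    exact (hξ.hasLaw hT.1 hT).hasGaussianLaw.integrable.const_mul γ
  have h := condExp_comp_prodMk_of_indep (hmF.trans (pastSigma_le hm ht.2)) hξm hlaw.aemeasurable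
    (indep_of_indep_of_le_right (hξ.incr_indep t ht T hT ht.2) hmF)
    (g := fun p => γ * (p.1 + p.2)) (by fun_prop) hint
  refine (condExp_congr_ae ?_).trans (h.trans (ae_of_all _ fun ω => ?_))
  · filter_upwards [hA] with ω hω
    rw [hω]
    ring
  · simp only
    rw [hlaw.map_eq, integral_const_mul, integral_add (integrable_const _) hid,
      integral_id_gaussianReal]
    simp

/-- The conditional law of `γ ξ_T` given the past up to time `t` is Gaussian with mean `γ ξ_t` and
variance `γ² (T - t)`. -/
lemma condProb_terminal (hγ : γ ≠ 0) (hm : ∀ t ∈ Icc 0 T, Measurable (ξ t))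
    (hξ : IsBrownianMotionOn (Icc 0 T) (pastSigma ξ) ξ Q) (hA : ∀ᵐ ω ∂Q, A ω = γ * ξ T ω)
    {t : ℝ} (ht : t ∈ Ico 0 T) {S : Set ℝ} (hS : MeasurableSet S) :
    Q⟦A ⁻¹' S | pastSigma ξ t⟧ =ᵐ[Q]
      fun ω => ∫ x in S, gaussianPDFReal (γ * ξ t ω) (γ ^ 2 * (T - t)).toNNReal x := by
  have ht' : t ∈ Icc 0 T := ⟨ht.1, ht.2.le⟩
  have hT : T ∈ Icc 0 T := ⟨ht.1.trans ht.2.le, le_rfl⟩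
  have hTt : 0 < T - t := sub_pos.2 ht.2
  have hlaw := hξ.incr_law t ht' T hT ht'.2
  set g : ℝ × ℝ → ℝ := fun p => S.indicator (fun _ => 1) (γ * (p.1 + p.2)) with hg
  have hgm : Measurable g := (measurable_const.indicator hS).comp (by fun_prop)
  have hint : Integrable (fun ω => g (ξ t ω, ξ T ω - ξ t ω)) Q := by
    refine Integrable.of_bound (C := 1)
      (hgm.comp ((hm t ht').prodMk ((hm T hT).sub (hm t ht')))).aestronglyMeasurable
      (ae_of_all _ fun ω => ?_)
    simp only [hg, indicator]
    split_ifs <;> simp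
  have h := condExp_comp_prodMk_of_indep (pastSigma_le hm ht'.2)
    (measurable_pastSigma ξ ⟨ht.1, le_rfl⟩) hlaw.aemeasurable
    (hξ.incr_indep t ht' T hT ht'.2) hgm hint
  refine (condExp_congr_ae ?_).trans (h.trans (ae_of_all _ fun ω => ?_))
  · filter_upwards [hA] with ω hω
    have h1 : γ * (ξ t ω + (ξ T ω - ξ t ω)) = A ω := by rw [hω]; ring
    simp only [hg, h1]
    rfl
  · simp only
    have hmap : (gaussianReal 0 (T - t).toNNReal).map (fun y => γ * (ξ t ω + y))
        = gaussianReal (γ * ξ t ω) (γ ^ 2 * (T - t)).toNNReal := by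
      have hcomp : (fun y => γ * (ξ t ω + y)) = (γ * ·) ∘ (ξ t ω + ·) := rfl
      rw [hcomp, ← Measure.map_map (by fun_prop) (by fun_prop), gaussianReal_map_const_add,
        gaussianReal_map_const_mul, zero_add]
      congr 1
      ext
      simp [hTt.le, (by positivity : 0 ≤ γ ^ 2 * (T - t))]
    have hmeas : AEMeasurable (fun y => γ * (ξ t ω + y)) (gaussianReal 0 (T - t).toNNReal) := by
      fun_prop
    rw [hlaw.map_eq, ← integral_map (f := S.indicator fun _ => (1 : ℝ)) hmeas
        (measurable_const.indicator hS).aestronglyMeasurable,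
      hmap, integral_indicator hS, setIntegral_const, smul_eq_mul, mul_one, measureReal_def,
      gaussianReal_apply_eq_integral _ (by simpa using by positivity),
      ENNReal.toReal_ofReal (integral_nonneg fun x => gaussianPDFReal_nonneg _ _ _)]

lemma exists_isEstimate (hT : 0 ≤ T) (hm : ∀ t ∈ Icc 0 T, Measurable (ξ t))
    (hξ : IsBrownianMotionOn (Icc 0 T) (pastSigma ξ) ξ Q) (hA : ∀ᵐ ω ∂Q, A ω = γ * ξ T ω) :
    ∃ m : ℝ → Ω → ℝ, IsEstimate Q T A ξ m := by
  obtain ⟨η, hηm, hη⟩ := exists_measurable_modification hT hm hξ.continuous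
  refine ⟨fun s ω => γ * η s ω, hηm.const_mul γ, fun s hs => ?_⟩
  have hs' : s ∈ Icc 0 T := ⟨hs.1, hs.2.le⟩
  have h := condExp_terminal hm hξ hA hs'
    (measurable_iff_comap_le.1 (measurable_pastSigma ξ ⟨hs.1, le_rfl⟩)) (comap_measurable (ξ s))
  filter_upwards [h, hη] with ω h1 h2
  rw [h1, h2 s hs']

/-- The drift of the driving process vanishes: as `σ T E[A | ξ_s] = ξ_s`, the driving process is
the information process. -/
lemma drivingProcess_eq (hT : 0 < T) (hγ : γ ≠ 0) (hσ : σ = 1 / (γ * T))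
    (hm : ∀ t ∈ Icc 0 T, Measurable (ξ t))
    (hξ : IsBrownianMotionOn (Icc 0 T) (pastSigma ξ) ξ Q) (hA : ∀ᵐ ω ∂Q, A ω = γ * ξ T ω)
    {m : ℝ → Ω → ℝ} (hest : IsEstimate Q T A ξ m) :
    ∀ᵐ ω ∂Q, ∀ t ∈ Ico 0 T, drivingProcess T σ ξ m t ω = ξ t ω := by
  obtain ⟨η, hηm, hη⟩ := exists_measurable_modification hT.le hm hξ.continuous
  have hset : MeasurableSet {p : ℝ × Ω | m p.1 p.2 = γ * η p.1 p.2} :=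
    measurableSet_eq_fun hest.measurable (hηm.const_mul γ)
  have h1 : ∀ᵐ s ∂(volume.restrict (Ico 0 T)), ∀ᵐ ω ∂Q, m s ω = γ * η s ω := by
    filter_upwards [ae_restrict_mem measurableSet_Ico] with s hs
    have hs' : s ∈ Icc 0 T := ⟨hs.1, hs.2.le⟩
    have h := condExp_terminal hm hξ hA hs'
      (measurable_iff_comap_le.1 (measurable_pastSigma ξ ⟨hs.1, le_rfl⟩)) (comap_measurable (ξ s))
    filter_upwards [h, hη, hest.ae_eq s hs] with ω h1 h2 h3
    rw [h3, h1, h2 s hs']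
  filter_upwards [(Measure.ae_ae_comm hset).1 h1, hη] with ω h2 h3 t ht
  rw [drivingProcess, sub_eq_self]
  refine intervalIntegral.integral_zero_ae ?_
  rw [ae_restrict_iff' measurableSet_Ico] at h2
  filter_upwards [h2] with s hs hst
  rw [uIoc_of_le ht.1] at hst
  have hsT : s ∈ Ico 0 T := ⟨hst.1.le, hst.2.trans_lt ht.2⟩
  rw [hs hsT, h3 s ⟨hsT.1, hsT.2.le⟩, hσ]
  field_simp
  ring

/-- The Gaussian conditional densities solve the master equation. -/
lemma solvesMasterEquation (hT : 0 < T) (hγ : γ ≠ 0) (hσ : σ = 1 / (γ * T))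
    (hm : ∀ t ∈ Icc 0 T, Measurable (ξ t))
    (hξ : IsBrownianMotionOn (Icc 0 T) (pastSigma ξ) ξ Q) {W : ℝ → Ω → ℝ}
    (hW : ∀ᵐ ω ∂Q, ∀ t ∈ Ico 0 T, W t ω = ξ t ω) :
    SolvesMasterEquation Q (pastSigma ξ) W T (bachelierInitialDensity T σ) (semilinearVol T σ)
      (fun t ω => semilinearDensity T σ (bachelierInitialDensity T σ) t (ξ t ω)) := by
  have hσ0 : σ ≠ 0 := by rw [hσ]; positivity
  have hv : ∀ t ∈ Ico 0 T, 0 < γ ^ 2 * (T - t) := fun t ht => by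
    have := sub_pos.2 ht.2
    positivity
  have hf : ∀ t ∈ Ico 0 T, ∀ z, semilinearDensity T σ (bachelierInitialDensity T σ) t z
      = gaussianPDFReal (γ * z) (γ ^ 2 * (T - t)).toNNReal := fun t ht z =>
    funext fun x => semilinearDensity_eq hT hγ hσ ht.2 z x
  refine ⟨?_, ae_of_all _ fun ω t ht => ?_, ae_of_all _ fun ω t ht => ?_, fun x t ht => ?_⟩
  · filter_upwards [hξ.continuous] with ω hω x
    have hω' : ContinuousOn (fun t => ξ t ω) (Ico 0 T) := hω.mono Ico_subset_Icc_self
    have hc : ContinuousOn (fun t => heatKernel (γ ^ 2 * (T - t)) (x - γ * ξ t ω)) (Ico 0 T) := by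
      have h2 : ContinuousOn (fun t : ℝ => 2 * Real.pi * (γ ^ 2 * (T - t))) (Ico 0 T) := by fun_prop
      have h3 : ContinuousOn (fun t : ℝ => 2 * (γ ^ 2 * (T - t))) (Ico 0 T) := by fun_prop
      unfold heatKernel
      refine (h2.sqrt.inv₀ fun t ht => ?_).mul
        (ContinuousOn.div (by fun_prop) h3 fun t ht => ?_).rexp
      · have := hv t ht
        positivity
      · exact mul_ne_zero two_ne_zero (hv t ht).ne'
    refine hc.congr fun t ht => ?_
    rw [hf t ht, gaussianPDFReal_eq_heatKernel (hv t ht).le]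
  · rw [hf t ht]
    exact ⟨integrable_gaussianPDFReal _ _,
      integral_gaussianPDFReal_eq_one _ (by simpa using hv t ht)⟩
  · simp only [hf t ht, semilinearVol, mul_assoc]
    exact ((integrable_mul_gaussianPDFReal _ (hv t ht)).const_mul _).const_mul _
  · obtain ⟨C, hu⟩ := exists_isHeatPotential_heatKernel hγ ht.2 x
    have hIto := hu.isItoIntegral (Q := Q) ⟨ht.1, ht.2.le⟩ hm hξ
    have hsub : ∀ s ∈ Icc 0 t, s ∈ Ico 0 T := fun s hs => ⟨hs.1, hs.2.trans_lt ht.2⟩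
    refine hIto.congr ?_ (ae_of_all _ fun ω s hs => ?_) (ae_of_all _ fun ω => ?_)
    · filter_upwards [hW] with ω hω s hs using (hω s (hsub s hs)).symm
    · have hs' := hsub s hs
      have hTs : T - s ≠ 0 := (sub_pos.2 hs'.2).ne'
      simp only [hf s hs', semilinearVol, mul_assoc]
      rw [integral_const_mul, integral_const_mul, integral_mul_gaussianPDFReal _ (hv s hs'),
        gaussianPDFReal_eq_heatKernel (hv s hs').le, hσ]
      field_simp
    · beta_reduce
      rw [hf t ht, gaussianPDFReal_eq_heatKernel (hv t ht).le, bachelierInitialDensity_eq hT hσ0,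
        gaussianPDFReal_eq_heatKernel (by positivity), hσ]
      congr 2
      · field_simp
        ring
      · ring

end Terminal

end Density

/-! ### Semilinear models and Brownian motion -/

section Models

variable {Ω : Type*} [mΩ : MeasurableSpace Ω] {Q : Measure Ω} {T γ σ : ℝ}
  {A : Ω → ℝ} {β B : ℝ → Ω → ℝ}

lemma withDensity_bachelierInitialDensity (hT : 0 < T) (hσ : σ ≠ 0) :
    volume.withDensity (fun x => ENNReal.ofReal (bachelierInitialDensity T σ x))
      = gaussianReal 0 (1 / (T * σ ^ 2)).toNNReal := by
  rw [gaussianReal_of_var_ne_zero _ (by simpa using by positivity)]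
  simp_rw [bachelierInitialDensity_eq hT hσ]
  rfl

lemma IsSemilinearModel.measurable_infoProcess {f₀ : ℝ → ℝ} (hM : IsSemilinearModel Q T f₀ A β)
    {t : ℝ} (ht : t ∈ Icc 0 T) : Measurable (infoProcess σ A β t) :=
  ((hM.terminal_measurable.const_mul σ).mul_const t).add (hM.bridge.measurable t ht)

/-- When the terminal value is centred Gaussian with variance `1 / (T σ²)`, its contribution
`s t / T` to the covariance completes that of the bridge to the covariance of Brownian motion. -/
lemma IsSemilinearModel.isBrownianMotionOn [IsProbabilityMeasure Q] (hT : 0 < T) (hσ : σ ≠ 0)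
    (hM : IsSemilinearModel Q T (bachelierInitialDensity T σ) A β) :
    IsBrownianMotionOn (Icc 0 T) (pastSigma (infoProcess σ A β)) (infoProcess σ A β) Q := by
  have hA : HasLaw A (gaussianReal 0 (1 / (T * σ ^ 2)).toNNReal) Q :=
    ⟨hM.terminal_measurable.aemeasurable, by
      rw [hM.terminal_law, withDensity_bachelierInitialDensity hT hσ]⟩
  have hA2 : MemLp A 2 Q := hA.hasGaussianLaw.memLp_two
  have hβ2 : ∀ t ∈ Icc 0 T, MemLp (β t) 2 Q := fun t ht =>
    (hM.bridge.gaussian.hasGaussianLaw_eval ⟨t, ht⟩).memLp_two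
  have hAβ : ∀ t ∈ Icc 0 T, cov[A, β t; Q] = 0 := fun t ht =>
    (hM.indep.comp (φ := id) (ψ := fun x : Icc (0 : ℝ) T → ℝ => x ⟨t, ht⟩) measurable_id
      (measurable_pi_apply _)).covariance_eq_zero hA2 (hβ2 t ht)
  have hAt : ∀ t : ℝ, MemLp (fun ω => σ * A ω * t) 2 Q := fun t =>
    (hA2.const_mul σ).mul_const t
  refine isBrownianMotionOn_pastSigma hT.le (fun t ht => hM.measurable_infoProcess ht) ⟨fun I => ?_⟩
    (fun t ht => ?_) (fun s hs t ht hst => ?_) ?_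
  · have hind : IndepFun A (fun ω => I.restrict fun t : Icc (0 : ℝ) T => β t ω) Q :=
      hM.indep.comp (φ := id) (ψ := fun x => I.restrict x) measurable_id (by fun_prop)
    let L : ℝ × (I → ℝ) →L[ℝ] (I → ℝ) :=
      { toFun p i := σ * p.1 * i + p.2 i
        map_add' p q := by ext i; simp; ring
        map_smul' c p := by ext i; simp; ring
        cont := by fun_prop }
    exact (hind.hasGaussianLaw hA.hasGaussianLaw (hM.bridge.gaussian.hasGaussianLaw I)).map L
  · have h0 : ∫ ω, A ω ∂Q = 0 := by rw [hA.integral_eq, integral_id_gaussianReal]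
    simp only [infoProcess]
    rw [integral_add ((hAt t).integrable one_le_two) ((hβ2 t ht).integrable one_le_two),
      hM.bridge.mean t ht, integral_mul_const, integral_const_mul, h0]
    simp
  · have hvar : cov[A, A; Q] = 1 / (T * σ ^ 2) := by
      rw [covariance_self hA.aemeasurable, hA.variance_eq, variance_id_gaussianReal,
        Real.coe_toNNReal _ (by positivity)]
    change cov[(fun ω => σ * A ω * s) + β s, (fun ω => σ * A ω * t) + β t; Q] = s
    rw [covariance_add_left (hAt s) (hβ2 s hs) ((hAt t).add (hβ2 t ht)),
      covariance_add_right (hAt s) (hAt t) (hβ2 t ht),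
      covariance_add_right (hβ2 s hs) (hAt t) (hβ2 t ht),
      hM.bridge.covariance s hs t ht hst]
    simp only [covariance_mul_const_left, covariance_mul_const_right, covariance_const_mul_left,
      covariance_const_mul_right]
    rw [covariance_comm (β s), hAβ s hs, hAβ t ht, hvar]
    field_simp
    ring
  · filter_upwards [hM.bridge.continuous] with ω hω
    exact (continuousOn_const.mul continuousOn_id).add hω

/-- The bridge vanishes at `T`, so the information process reveals the terminal value there. -/
lemma IsSemilinearModel.terminal_ae_eq [IsProbabilityMeasure Q] {f₀ : ℝ → ℝ} (hT : 0 < T)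
    (hγ : γ ≠ 0) (hσ : σ = 1 / (γ * T)) (hM : IsSemilinearModel Q T f₀ A β) :
    ∀ᵐ ω ∂Q, A ω = γ * infoProcess σ A β T ω := by
  have hTT : T ∈ Icc 0 T := ⟨hT.le, le_rfl⟩
  filter_upwards [ae_eq_zero_of_hasGaussianLaw
    (hM.bridge.gaussian.hasGaussianLaw_eval ⟨T, hTT⟩) (hM.bridge.mean T hTT)
    (by rw [hM.bridge.covariance T hTT T hTT le_rfl]; simp)] with ω hω
  rw [infoProcess, hω, hσ]
  field_simp
  ring

/-- The terminal value `γ B_T` of a Brownian motion and the bridge `B_t - (t / T) B_T` form a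
semilinear model: being jointly Gaussian and uncorrelated, they are independent. -/
lemma IsBrownianMotionOn.isSemilinearModel [IsProbabilityMeasure Q] (hT : 0 < T) (hγ : γ ≠ 0)
    (hσ : σ = 1 / (γ * T))
    (hm : ∀ t ∈ Icc 0 T, Measurable (B t))
    (hB : IsBrownianMotionOn (Icc 0 T) (pastSigma B) B Q) :
    IsSemilinearModel Q T (bachelierInitialDensity T σ) (fun ω => γ * B T ω)
      (fun t ω => B t ω - t / T * B T ω) := by
  have hσ0 : σ ≠ 0 := by rw [hσ]; positivity
  have hTT : T ∈ Icc 0 T := ⟨hT.le, le_rfl⟩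
  have hG := hB.isGaussianProcess hT.le
  have hL2 : ∀ t ∈ Icc 0 T, MemLp (B t) 2 Q := fun t ht =>
    (hB.hasLaw hT.le ht).hasGaussianLaw.memLp_two
  have hcT : ∀ c : ℝ, MemLp (fun ω => c * B T ω) 2 Q := fun c => (hL2 T hTT).const_mul c
  have hβ2 : ∀ t ∈ Icc 0 T, MemLp (fun ω => B t ω - t / T * B T ω) 2 Q := fun t ht =>
    (hL2 t ht).sub (hcT _)
  have hβm : ∀ t ∈ Icc 0 T, Measurable fun ω => B t ω - t / T * B T ω := fun t ht =>
    (hm t ht).sub ((hm T hTT).const_mul _)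
  have hmean : ∀ t ∈ Icc 0 T, ∫ ω, B t ω ∂Q = 0 := fun t ht => by
    rw [(hB.hasLaw hT.le ht).integral_eq, integral_id_gaussianReal]
  -- the bridge is uncorrelated with `B_T`
  have hcov : ∀ t ∈ Icc 0 T, cov[B T, fun ω => B t ω - t / T * B T ω; Q] = 0 := fun t ht => by
    rw [covariance_fun_sub_right (hL2 T hTT) (hL2 t ht) (hcT _), covariance_comm,
      hB.covariance hT.le ht hTT ht.2, covariance_const_mul_right,
      hB.covariance hT.le hTT hTT le_rfl]
    field_simp
    ring
  refine ⟨?_, fun x => ?_, (hm T hTT).const_mul γ, ?_, ⟨hβm, ?_, fun t ht => ?_,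
    fun s hs t ht hst => ?_, ?_⟩, ?_⟩
  · unfold bachelierInitialDensity
    fun_prop
  · unfold bachelierInitialDensity
    positivity
  · rw [withDensity_bachelierInitialDensity hT hσ0,
      (gaussianReal_const_mul (hB.hasLaw hT.le hTT) γ).map_eq, mul_zero]
    congr 1
    ext
    rw [Real.coe_toNNReal _ (by positivity)]
    simp only [NNReal.coe_mul, NNReal.coe_mk, Real.coe_toNNReal _ hT.le]
    rw [hσ]
    field_simp
  · classical
    refine hG.of_isGaussianProcess fun t => ⟨{t, ⟨T, hTT⟩},
      { toFun x := x ⟨t, by simp⟩ - (t : ℝ) / T * x ⟨⟨T, hTT⟩, by simp⟩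
        map_add' x y := by simp; ring
        map_smul' c x := by simp; ring }, by simp⟩
  · rw [integral_sub ((hL2 t ht).integrable one_le_two) ((hcT _).integrable one_le_two),
      integral_const_mul, hmean t ht, hmean T hTT]
    simp
  · rw [covariance_fun_sub_left (hL2 s hs) (hcT _) (hβ2 t ht), covariance_const_mul_left,
      hcov t ht, covariance_fun_sub_right (hL2 s hs) (hL2 t ht) (hcT _),
      hB.covariance hT.le hs ht hst, covariance_const_mul_right,
      hB.covariance hT.le hs hTT hs.2]
    field_simp
    ring
  · filter_upwards [hB.continuous] with ω hω
    exact hω.sub ((continuousOn_id.div_const T).mul continuousOn_const)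
  · have hjoint : IndepFun (fun ω (_ : Unit) => B T ω)
        (fun ω (t : Icc (0 : ℝ) T) => B t ω - t / T * B T ω) Q := by
      apply IsGaussianProcess.indepFun_of_covariance_eq_zero
        (X := fun (_ : Unit) ω => B T ω) (Y := fun (t : Icc (0 : ℝ) T) ω => B t ω - t / T * B T ω)
      · classical
        apply hG.of_isGaussianProcess
        rintro (_ | t)
        · exact ⟨{⟨T, hTT⟩},
            { toFun x := x ⟨⟨T, hTT⟩, by simp⟩
              map_add' x y := by simp
              map_smul' c x := by simp }, by simp⟩
        · exact ⟨{t, ⟨T, hTT⟩},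
            { toFun x := x ⟨t, by simp⟩ - (t : ℝ) / T * x ⟨⟨T, hTT⟩, by simp⟩
              map_add' x y := by simp; ring
              map_smul' c x := by simp; ring }, by simp⟩
      · exact fun _ => (hm T hTT).aemeasurable
      · exact fun t => (hβm t t.2).aemeasurable
      · exact fun _ t => hcov t t.2
    exact hjoint.comp (φ := fun x : Unit → ℝ => γ * x ()) (ψ := id) (by fun_prop) measurable_id

end Models

end CondDensity

theorem proposition7p1 {Ω : Type*} [MeasurableSpace Ω] (Q : Measure Ω) [IsProbabilityMeasure Q]
    (T γ σ : ℝ) (hT : 0 < T) (hγ : γ ≠ 0) (hσ : σ = 1 / (γ * T)) :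
    -- the initial density is that of the law `N(0, 1 / (T σ²))`
    (∀ x, CondDensity.bachelierInitialDensity T σ x =
      gaussianPDFReal 0 (1 / (T * σ ^ 2)).toNNReal x) ∧
    -- every semilinear model with this initial density and this `σ` is a Bachelier model
    (∀ (A : Ω → ℝ) (β : ℝ → Ω → ℝ),
      CondDensity.IsSemilinearModel Q T (CondDensity.bachelierInitialDensity T σ) A β →
      let ξ : ℝ → Ω → ℝ := CondDensity.infoProcess σ A β
      let F : ℝ → MeasurableSpace Ω := CondDensity.pastSigma ξ
      let f : ℝ → Ω → ℝ → ℝ := fun t ω =>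
        CondDensity.semilinearDensity T σ (CondDensity.bachelierInitialDensity T σ) t (ξ t ω)
      CondDensity.IsBrownianMotionOn (Icc 0 T) F ξ Q ∧
      (∀ᵐ ω ∂Q, A ω = γ * ξ T ω) ∧
      (∃ m : ℝ → Ω → ℝ, CondDensity.IsEstimate Q T A ξ m) ∧
      ∀ m : ℝ → Ω → ℝ, CondDensity.IsEstimate Q T A ξ m →
        let W : ℝ → Ω → ℝ := CondDensity.drivingProcess T σ ξ m
        CondDensity.IsBrownianMotionOn (Ico 0 T) F W Q ∧
        (∀ᵐ ω ∂Q, ∀ t ∈ Ico 0 T, W t ω = ξ t ω) ∧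
        (∀ t ∈ Ico 0 T, Q[A | F t] =ᵐ[Q] fun ω => γ * W t ω) ∧
        (∀ᵐ ω ∂Q, ∀ t ∈ Ico 0 T, ∀ x,
          f t ω x = CondDensity.bachelierDensity T γ t (W t ω) x ∧
          f t ω x = gaussianPDFReal (γ * W t ω) (γ ^ 2 * (T - t)).toNNReal x) ∧
        (∀ t ∈ Ico 0 T, ∀ S : Set ℝ, MeasurableSet S →
          Q⟦A ⁻¹' S | F t⟧ =ᵐ[Q] fun ω => ∫ x in S, f t ω x) ∧
        CondDensity.SolvesMasterEquation Q F W T (CondDensity.bachelierInitialDensity T σ)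
          (CondDensity.semilinearVol T σ) f) ∧
    -- every Bachelier model `γ B` on `[0, T]` arises in this way, with information process `B`
    (∀ B : ℝ → Ω → ℝ, (∀ t ∈ Icc 0 T, Measurable (B t)) →
      CondDensity.IsBrownianMotionOn (Icc 0 T) (CondDensity.pastSigma B) B Q →
      ∃ (A : Ω → ℝ) (β : ℝ → Ω → ℝ),
        CondDensity.IsSemilinearModel Q T (CondDensity.bachelierInitialDensity T σ) A β ∧
        (∀ ω, A ω = γ * B T ω) ∧
        ∀ t ∈ Icc 0 T, ∀ ω, CondDensity.infoProcess σ A β t ω = B t ω) := by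
  have hσ0 : σ ≠ 0 := by rw [hσ]; positivity
  refine ⟨CondDensity.bachelierInitialDensity_eq hT hσ0, fun A β hM => ?_, fun B hm hB => ?_⟩
  · intro ξ F f
    have hm : ∀ t ∈ Icc 0 T, Measurable (ξ t) := fun t ht => hM.measurable_infoProcess ht
    have hξ : CondDensity.IsBrownianMotionOn (Icc 0 T) F ξ Q := hM.isBrownianMotionOn hT hσ0
    have hA : ∀ᵐ ω ∂Q, A ω = γ * ξ T ω := hM.terminal_ae_eq hT hγ hσ
    refine ⟨hξ, hA, CondDensity.exists_isEstimate hT.le hm hξ hA, fun m hest => ?_⟩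
    intro W
    have hW : ∀ᵐ ω ∂Q, ∀ t ∈ Ico 0 T, W t ω = ξ t ω :=
      CondDensity.drivingProcess_eq hT hγ hσ hm hξ hA hest
    have hf : ∀ t ∈ Ico 0 T, ∀ ω x,
        f t ω x = gaussianPDFReal (γ * ξ t ω) (γ ^ 2 * (T - t)).toNNReal x := fun t ht ω x =>
      CondDensity.semilinearDensity_eq hT hγ hσ ht.2 (ξ t ω) x
    refine ⟨hξ.congr Ico_subset_Icc_self ⟨le_rfl, hT⟩ hW, hW, fun t ht => ?_, ?_,
      fun t ht S hS => ?_, CondDensity.solvesMasterEquation hT hγ hσ hm hξ hW⟩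
    · have h := CondDensity.condExp_terminal hm hξ hA ⟨ht.1, ht.2.le⟩ le_rfl
        (CondDensity.measurable_pastSigma ξ ⟨ht.1, le_rfl⟩)
      filter_upwards [h, hW] with ω h1 h2
      rw [h1, h2 t ht]
    · filter_upwards [hW] with ω hω t ht x
      rw [hω t ht, CondDensity.bachelierDensity_eq hγ ht.2]
      exact ⟨hf t ht ω x, hf t ht ω x⟩
    · simp_rw [hf t ht]
      exact CondDensity.condProb_terminal hγ hm hξ hA ht hS
  · refine ⟨fun ω => γ * B T ω, fun t ω => B t ω - t / T * B T ω,
      hB.isSemilinearModel hT hγ hσ hm, fun _ => rfl, fun t _ ω => ?_⟩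
    simp only [CondDensity.infoProcess]
    rw [hσ]
    field_simp
    ring
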